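/- A partition is a finite multiset of positive integers; write $\lambda=(1^{m_1}2^{m_2}\cdots)$ if $i$ occurs $m_i$ times as a part of $\lambda$, let $|\lambda|$ be the sum and $\ell(\lambda)$ the number of its parts, $\lambda'$ the conjugate (transposed) partition, $\operatorname{sgn}(\lambda)=(-1)^{\#\{\text{even parts of }\lambda\}}$, and $z_\lambda=\prod_{i\ge 1} m_i!\,i^{m_i}$. Put $2\lambda=(1^{2m_1}2^{2m_2}\cdots)$, $2\cdot\lambda=(2^{m_1}4^{m_2}\cdots)$, and let $\lambda\cup\mu$ be the partition in which the multiplicities of $\lambda$ and $\mu$ are added. For $\lambda,\pi\vdash n$ let $\chi^\lambda_\pi$ be the value of the irreducible complex character of the symmetric group $S_n$ attached to $\lambda$ (the character of the Specht module of $\lambda$, so that $\lambda=(n)$ gives the trivial and $\lambda=(1^n)$ the sign character) at the permutations of cycle type $\pi$. For a partition $\pi$ define $$C^{\pm}_\pi=\sum \frac{(-1)^{\ell(\tau_s)}}{z_{\rho_+}\,z_{\rho_-}\,z_{2\cdot\tau_s}\,z_{2\cdot\tau_p}},$$ where the sum is over all quadruples of partitions $(\rho_+,\rho_-,\tau_s,\tau_p)$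 with $\rho_+\cup\rho_-\cup 2\cdot\tau_s\cup 2\tau_p=\pi$ and with $|\rho_-|$ even for $C^+_\pi$, and $|\rho_-|$ odd for $C^-_\pi$. Put $C_\pi=C^+_\pi+C^-_\pi$ and $D_\pi=C^+_\pi-C^-_\pi$, and for a partition $\lambda$ of $n\ge 0$ define $$a^+_\lambda=\sum_{\pi\vdash n}\operatorname{sgn}(\pi)\,C_\pi\,\chi^\lambda_\pi,\qquad a^-_\lambda=\sum_{\pi\vdash n}\operatorname{sgn}(\pi)\,D_\pi\,\chi^\lambda_\pi .$$ Theorem. For every partition $\lambda=(1^{r_1}2^{r_2}\cdots)$, $$a^+_\lambda=(r_1+1)(r_2+1)\cdots,\qquad a^-_\lambda=\begin{cases}1&\text{if all parts of }\lambda'\text{ are even,}\\0&\text{otherwise.}\end{cases}$$ -/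

import Mathlib

namespace SchurMult

/-! ### Partitions

A partition is a multiset of positive integers; partitions of `n` are Mathlib's `Nat.Partition n`,
with underlying multiset `parts`. The union `lam ∪ mu` (adding multiplicities) is the sum of
multisets, and for `s = 2` the two operations `s · lam` (multiply every part by `s`) and `s lam`
(multiply every multiplicity by `s`) are `lam.map (2 * ·)` and `2 • lam`. -/

/-- `z_μ = ∏ i, r_i! * i ^ r_i` for `μ = (1^{r₁} 2^{r₂} ⋯)`. -/
def zee (m : Multiset ℕ) : ℕ :=
  ∏ i ∈ m.toFinset, (m.count i).factorial * i ^ m.count i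

/-- The parity `(-1) ^ (number of even parts)`. -/
def parity (m : Multiset ℕ) : ℤ :=
  (-1) ^ m.countP Even

/-- The finite set of all partitions of all integers `k ≤ N`. -/
def partitionsUpTo (N : ℕ) : Finset (Multiset ℕ) :=
  (Finset.range (N + 1)).biUnion fun k =>
    (Finset.univ : Finset (Nat.Partition k)).image Nat.Partition.parts

/-- The set of quadruples `(ρ₊, ρ₋, τ_s, τ_p)` of partitions with
`ρ₊ ∪ ρ₋ ∪ 2 · τ_s ∪ 2 τ_p = m`. Each of them has weight at most `|m|`, so nothing is lost by
taking them in the finite set `partitionsUpTo |m|`; see `mem_quadruples`. -/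
def quadruples (m : Multiset ℕ) :
    Finset (Multiset ℕ × Multiset ℕ × Multiset ℕ × Multiset ℕ) :=
  (partitionsUpTo m.sum ×ˢ partitionsUpTo m.sum ×ˢ partitionsUpTo m.sum ×ˢ
    partitionsUpTo m.sum).filter
    fun q => q.1 + q.2.1 + q.2.2.1.map (2 * ·) + 2 • q.2.2.2 = m

theorem mem_partitionsUpTo {N : ℕ} {m : Multiset ℕ} :
    m ∈ partitionsUpTo N ↔ (∀ i ∈ m, 0 < i) ∧ m.sum ≤ N := by
  simp only [partitionsUpTo, Finset.mem_biUnion, Finset.mem_range, Finset.mem_image,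
    Finset.mem_univ, true_and]
  constructor
  · rintro ⟨k, hk, p, rfl⟩
    exact ⟨fun i hi => p.parts_pos hi, by rw [p.parts_sum]; omega⟩
  · rintro ⟨h, hs⟩
    exact ⟨m.sum, by omega, ⟨m, fun {i} hi => h i hi, rfl⟩, rfl⟩

theorem mem_quadruples {m a b s t : Multiset ℕ} :
    (a, b, s, t) ∈ quadruples m ↔
      (∀ i ∈ a, 0 < i) ∧ (∀ i ∈ b, 0 < i) ∧ (∀ i ∈ s, 0 < i) ∧ (∀ i ∈ t, 0 < i) ∧
        a + b + s.map (2 * ·) + 2 • t = m := by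
  simp only [quadruples, Finset.mem_filter, Finset.mem_product, mem_partitionsUpTo]
  constructor
  · rintro ⟨⟨h1, h2, h3, h4⟩, h⟩
    exact ⟨h1.1, h2.1, h3.1, h4.1, h⟩
  · rintro ⟨h1, h2, h3, h4, h⟩
    have hsum : a.sum + b.sum + 2 * s.sum + 2 * t.sum = m.sum := by
      rw [← h]
      simp [two_nsmul, two_mul]
    exact ⟨⟨⟨h1, by omega⟩, ⟨h2, by omega⟩, ⟨h3, by omega⟩, ⟨h4, by omega⟩⟩, h⟩

/-- The summand `(-1)^{ℓ(τ_s)} / (z_{ρ₊} z_{ρ₋} z_{2·τ_s} z_{2·τ_p})`. -/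
noncomputable def quadWeight (q : Multiset ℕ × Multiset ℕ × Multiset ℕ × Multiset ℕ) : ℂ :=
  (-1) ^ q.2.2.1.card /
    ((zee q.1 : ℂ) * zee q.2.1 * zee (q.2.2.1.map (2 * ·)) * zee (q.2.2.2.map (2 * ·)))

/-- `C⁺_π`: the quadruples with `|ρ₋|` even. -/
noncomputable def Cplus (m : Multiset ℕ) : ℂ :=
  ∑ q ∈ (quadruples m).filter (fun q => Even q.2.1.sum), quadWeight q

/-- `C⁻_π`: the quadruples with `|ρ₋|` odd. -/
noncomputable def Cminus (m : Multiset ℕ) : ℂ :=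
  ∑ q ∈ (quadruples m).filter (fun q => Odd q.2.1.sum), quadWeight q

/-- `C_π = C⁺_π + C⁻_π`. -/
noncomputable def coeffC (m : Multiset ℕ) : ℂ := Cplus m + Cminus m

/-- `D_π = C⁺_π - C⁻_π`. -/
noncomputable def coeffD (m : Multiset ℕ) : ℂ := Cplus m - Cminus m

/-! ### Young diagrams of partitions -/

/-- The Young diagram of a partition: its `i`-th row has length the `i`-th largest part. -/
def diagram {n : ℕ} (lam : Nat.Partition n) : YoungDiagram :=
  YoungDiagram.ofRowLens (lam.parts.sort (· ≥ ·)) (lam.parts.pairwise_sort (· ≥ ·)).sortedGE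

/-- The parts of the conjugate partition: the row lengths of the transposed diagram. -/
def conjParts {n : ℕ} (lam : Nat.Partition n) : Multiset ℕ :=
  ((diagram lam).transpose.rowLens : Multiset ℕ)

theorem card_cells {n : ℕ} (lam : Nat.Partition n) : (diagram lam).cells.card = n := by
  have key : ∀ w : List ℕ, (YoungDiagram.cellsOfRowLens w).card = w.sum := by
    intro w
    induction w with
    | nil => rfl
    | cons k w ih =>
      rw [YoungDiagram.cellsOfRowLens, Finset.card_union_of_disjoint, Finset.card_map, ih]
      · simp
      · rw [Finset.disjoint_left]
        rintro ⟨i, j⟩ h1 h2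
        simp only [Finset.mem_product, Finset.mem_singleton] at h1
        obtain ⟨c, _, hc⟩ := Finset.mem_map.1 h2
        have h3 : c.1.succ = i := congrArg Prod.fst hc
        omega
  have h := key (lam.parts.sort (· ≥ ·))
  rw [← Multiset.sum_coe, Multiset.sort_eq, lam.parts_sum] at h
  exact h

/-! ### The irreducible characters of the symmetric group -/

section Specht

variable {n : ℕ} (lam : Nat.Partition n)

/-- A numbering of the cells of the diagram of `lam` by `Fin n` (a Young tableau). -/
noncomputable def tableau : (diagram lam).cells ≃ Fin n :=
  Finset.equivFinOfCardEq (card_cells lam)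

/-- The row of the tableau that contains the entry `i`. -/
noncomputable def rowOf (i : Fin n) : ℕ := ((tableau lam).symm i : ℕ × ℕ).1

/-- The column of the tableau that contains the entry `i`. -/
noncomputable def colOf (i : Fin n) : ℕ := ((tableau lam).symm i : ℕ × ℕ).2

/-- The row symmetrizer `∑ σ`, over the permutations preserving each row. -/
noncomputable def rowSymmetrizer : MonoidAlgebra ℂ (Equiv.Perm (Fin n)) :=
  ∑ σ : Equiv.Perm (Fin n) with ∀ i, rowOf lam (σ i) = rowOf lam i, MonoidAlgebra.of ℂ _ σ

/-- The column antisymmetrizer `∑ sgn(σ) σ`, over the permutations preserving each column. -/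
noncomputable def colAntisymmetrizer : MonoidAlgebra ℂ (Equiv.Perm (Fin n)) :=
  ∑ σ : Equiv.Perm (Fin n) with ∀ i, colOf lam (σ i) = colOf lam i,
    ((Equiv.Perm.sign σ : ℤ) : ℂ) • MonoidAlgebra.of ℂ _ σ

/-- The irreducible `ℂ[S_n]`-module attached to `lam`: the left ideal generated by the Young
symmetrizer. For `lam = (n)` it is the trivial, for `lam = (1^n)` the sign representation. -/
noncomputable def spechtModule : Ideal (MonoidAlgebra ℂ (Equiv.Perm (Fin n))) :=
  Ideal.span {rowSymmetrizer lam * colAntisymmetrizer lam}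

/-- The representation of `S_n` on the Specht module, by left multiplication. -/
noncomputable def spechtRep : Representation ℂ (Equiv.Perm (Fin n)) (spechtModule lam) :=
  ((Algebra.lsmul ℂ ℂ (spechtModule lam)).toRingHom.toMonoidHom).comp
    (MonoidAlgebra.of ℂ (Equiv.Perm (Fin n)))

theorem exists_perm_of_partition (π : Nat.Partition n) :
    ∃ σ : Equiv.Perm (Fin n), σ.partition.parts = π.parts := by
  have hsplit := Multiset.filter_add_not (fun i => 2 ≤ i) π.parts
  have hone : π.parts.filter (fun i => ¬ 2 ≤ i) =
      Multiset.replicate (π.parts.filter (fun i => ¬ 2 ≤ i)).card 1 := by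
    rw [Multiset.eq_replicate_card]
    intro i hi
    rw [Multiset.mem_filter] at hi
    have := π.parts_pos hi.1
    omega
  have hsum : (π.parts.filter (fun i => 2 ≤ i)).sum +
      (π.parts.filter (fun i => ¬ 2 ≤ i)).card = n := by
    have h := congrArg Multiset.sum hsplit
    rw [Multiset.sum_add, π.parts_sum, hone, Multiset.sum_replicate] at h
    simpa using h
  obtain ⟨σ, hσ⟩ := (Equiv.Perm.exists_with_cycleType_iff (Fin n)
    (m := π.parts.filter (fun i => 2 ≤ i))).2
    ⟨by rw [Fintype.card_fin]; omega, fun a ha => (Multiset.mem_filter.1 ha).2⟩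
  refine ⟨σ, ?_⟩
  have hcard : Fintype.card (Fin n) - σ.support.card =
      (π.parts.filter (fun i => ¬ 2 ≤ i)).card := by
    rw [← Equiv.Perm.sum_cycleType, hσ, Fintype.card_fin]
    omega
  rw [Equiv.Perm.parts_partition, hσ, hcard, ← hone]
  exact hsplit

/-- `χ^lam_π`: the value of the irreducible character of `S_n` attached to `lam` at a permutation
of cycle type `π` (fixed points counted as parts `1`). -/
noncomputable def chi (π : Nat.Partition n) : ℂ :=
  (spechtRep lam).character (exists_perm_of_partition π).choose

/-- The choice of the permutation in `chi` is immaterial. -/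
theorem chi_eq (π : Nat.Partition n) (σ : Equiv.Perm (Fin n)) (h : σ.partition.parts = π.parts) :
    chi lam π = (spechtRep lam).character σ := by
  have hc : IsConj (exists_perm_of_partition π).choose σ :=
    Equiv.Perm.partition_eq_of_isConj.2
      (Nat.Partition.ext ((exists_perm_of_partition π).choose_spec.trans h.symm))
  obtain ⟨g, hg⟩ := isConj_iff.1 hc
  rw [chi, ← hg, Representation.char_conj]

/-- `a⁺_lam = ∑_{π ⊢ n} sgn(π) C_π χ^lam_π`. -/
noncomputable def aPlus : ℂ :=
  ∑ π : Nat.Partition n, (parity π.parts : ℂ) * coeffC π.parts * chi lam π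

/-- `a⁻_lam = ∑_{π ⊢ n} sgn(π) D_π χ^lam_π`. -/
noncomputable def aMinus : ℂ :=
  ∑ π : Nat.Partition n, (parity π.parts : ℂ) * coeffD π.parts * chi lam π

end Specht

end SchurMult

/-! By the Frobenius character formula, `χ^λ` is the coefficient of `x ^ (λ + δ)` in the product of
the alternant `∏_{i<j} (x_i - x_j)` with the power sum `p_π`. The irreducible representations of the
symmetric group are real, so their Frobenius–Schur indicators are `1`, that is,
`∑_h χ^λ (h²) = n!`; hence the sum of all Schur polynomials is the exponential of `∑ p_k / k` over
odd `k` plus `∑ p_k² / (2k)` over all `k`. Multiplied by `∑_k s ^ k e_k`, this exponential becomes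
the generating function of `sgn(π) C_π p_π` for `s = 1` and of `sgn(π) D_π p_π` for `s = -1`. By
Pieri's rule the coefficient of the Schur polynomial of `λ` in the product counts, with weight
`s ^ k`, the vertical strips of size `k` that can be removed from `λ`. Such a strip consists of the
last boxes of `j ≤ r_i` rows of each length `i`, so the total is `∏_i (1 + s + ⋯ + s ^ r_i)`. -/

namespace SchurMult

open Finset MonoidAlgebra HopfAlgebra

section GroupAlgebra

variable {K G : Type*} [CommRing K] [Group G]

theorem antipode_of (g : G) : antipode K (of K G g) = of K G g⁻¹ := by
  simp [antipode_single]

theorem antipode_antipode (x : MonoidAlgebra K G) : antipode K (antipode K x) = x := by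
  induction x using MonoidAlgebra.induction_linear with
  | zero => simp
  | add x y hx hy => rw [map_add, map_add, hx, hy]
  | single g r => simp [antipode_single]

theorem coeff_one_mul_comm (x y : MonoidAlgebra K G) : (x * y).coeff 1 = (y * x).coeff 1 := by
  induction x using MonoidAlgebra.induction_linear with
  | zero => simp
  | add x x' hx hx' => simp [add_mul, mul_add, hx, hx']
  | single g r => simp [coeff_single_mul_apply, coeff_mul_single_apply, mul_comm]

theorem coeff_antipode (x : MonoidAlgebra K G) (g : G) :
    (antipode K x).coeff g = x.coeff g⁻¹ := by
  induction x using MonoidAlgebra.induction_linear with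
  | zero => simp
  | add x y hx hy => simp [hx, hy]
  | single h r =>
    classical
    simp only [antipode_single, CommSemiring.antipode_eq_id, LinearMap.id_coe, id_eq,
      coeff_single, Finsupp.single_apply, inv_eq_iff_eq_inv]

theorem sum_coeff_smul_of [Fintype G] (x : MonoidAlgebra K G) :
    ∑ g, x.coeff g • of K G g = x := by
  conv_rhs => rw [← MonoidAlgebra.sum_coeff_single x, Finsupp.sum_fintype _ _ (by simp)]
  exact sum_congr rfl fun g _ => by simp

variable (K G) in
/-- The sum of the squares of all group elements. Its trace in a representation is the
Frobenius–Schur indicator, up to the factor `|G|`. -/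
noncomputable def sumSquares [Fintype G] : MonoidAlgebra K G := ∑ h : G, of K G (h * h)

theorem commute_sumSquares [Fintype G] (x : MonoidAlgebra K G) : Commute x (sumSquares K G) := by
  have hof (g : G) : Commute (of K G g) (sumSquares K G) := by
    rw [commute_iff_eq, sumSquares, mul_sum, sum_mul]
    refine sum_equiv (MulAut.conj g).toEquiv (by simp) fun h _ => ?_
    rw [← map_mul, ← map_mul]
    simp [mul_assoc]
  rw [← sum_coeff_smul_of x]
  exact Commute.sum_left _ _ _ fun g _ => (hof g).smul_left _

theorem sum_of_mul_mul_of [Fintype G] (x : MonoidAlgebra K G) :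
    ∑ h : G, of K G h * x * of K G h = antipode K x * sumSquares K G := by
  induction x using MonoidAlgebra.induction_linear with
  | zero => simp
  | add x y hx hy => simp only [mul_add, add_mul, sum_add_distrib, map_add, hx, hy]
  | single g r =>
    rw [antipode_single, sumSquares, mul_sum]
    refine sum_equiv (Equiv.mulLeft g) (by simp) fun h _ => ?_
    simp [single_mul_single, mul_assoc]

theorem trace_mulRight [Fintype G] (x : MonoidAlgebra K G) :
    LinearMap.trace K _ (LinearMap.mulRight K x) = Fintype.card G * x.coeff 1 := by
  classical
  rw [LinearMap.trace_eq_matrix_trace K (MonoidAlgebra.basis G K), Matrix.trace]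
  have hdiag (g : G) : (LinearMap.toMatrix (MonoidAlgebra.basis G K) (MonoidAlgebra.basis G K)
      (LinearMap.mulRight K x)).diag g = x.coeff 1 := by
    rw [Matrix.diag_apply, LinearMap.toMatrix_apply]
    change (single g 1 * x).coeff g = _
    rw [coeff_single_mul_apply, inv_mul_cancel, one_mul]
  rw [sum_congr rfl fun g _ => hdiag g, sum_const, nsmul_eq_mul, card_univ]

end GroupAlgebra

section LeftIdealTrace

variable {K A : Type*} [Field K] [Ring A] [Algebra K A]

variable (K) in
/-- The trace of the left multiplication by an element of a `K`-algebra on a left ideal. -/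
noncomputable def leftIdealTrace (I : Ideal A) : A →ₗ[K] K :=
  LinearMap.trace K I ∘ₗ (Algebra.lsmul K K I).toLinearMap

theorem leftIdealTrace_eq_zero {I : Ideal A} {x : A} (h : ∀ v ∈ I, x * v = 0) :
    leftIdealTrace K I x = 0 := by
  have hx : Algebra.lsmul K K I x = 0 := LinearMap.ext fun v => Subtype.ext (h v v.2)
  change LinearMap.trace K I (Algebra.lsmul K K I x) = 0
  rw [hx, map_zero]

theorem leftIdealTrace_eq_of_rank_one [Module.Finite K A] {I : Ideal A} {x : A} (f : A →ₗ[K] K)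
    (c : I) (h : ∀ v ∈ I, x * v = f v • (c : A)) : leftIdealTrace K I x = f c := by
  let fI : I →ₗ[K] K :=
    { toFun := fun v => f v
      map_add' := fun v w => map_add f (v : A) w
      map_smul' := fun k v => map_smul f k (v : A) }
  have hx : Algebra.lsmul K K I x = fI.smulRight c :=
    LinearMap.ext fun v => Subtype.ext (h v v.2)
  have : Module.Finite K I := inferInstanceAs (Module.Finite K (I.restrictScalars K))
  change LinearMap.trace K I (Algebra.lsmul K K I x) = fI c
  rw [hx, LinearMap.trace_smulRight]

/-- Right multiplication by `c` maps the whole algebra into `A c`, so its traces on `A` and on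
`A c` agree. -/
theorem leftIdealTrace_span_eq_trace_mulRight [Module.Finite K A] {c z : A}
    (h : ∀ v ∈ Ideal.span {c}, z * v = v * c) :
    leftIdealTrace K (Ideal.span {c}) z = LinearMap.trace K A (LinearMap.mulRight K c) := by
  let p := (Ideal.span {c}).restrictScalars K
  have hmem (x : A) : LinearMap.mulRight K c x ∈ p :=
    Ideal.mul_mem_left _ x (Ideal.subset_span rfl)
  rw [← LinearMap.trace_restrict_eq_of_forall_mem p _ hmem]
  exact congrArg (LinearMap.trace K p) (LinearMap.ext fun v : p => Subtype.ext (h v v.2))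

end LeftIdealTrace

section PrimitivePair

variable {K G : Type*} [Field K] [Group G] {a b : MonoidAlgebra K G}

theorem mul_mul_eq_coeff_one_smul (hone : (a * b).coeff 1 = 1)
    (hab : ∀ x, ∃ k : K, a * x * b = k • (a * b)) (x : MonoidAlgebra K G) :
    a * x * b = (a * x * b).coeff 1 • (a * b) := by
  obtain ⟨k, hk⟩ := hab x
  rw [hk, coeff_smul_apply, hone, smul_eq_mul, mul_one]

theorem mul_of_mul_eq_coeff_smul (ha : antipode K a = a) (hb : antipode K b = b)
    (hone : (a * b).coeff 1 = 1) (hab : ∀ x, ∃ k : K, a * x * b = k • (a * b)) (g : G) :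
    a * of K G g * b = (a * b).coeff g • (a * b) := by
  have hcoeff : (a * of K G g * b).coeff 1 = (a * b).coeff g := by
    calc (a * of K G g * b).coeff 1 = (of K G g * (b * a)).coeff 1 := by
          rw [mul_assoc, coeff_one_mul_comm, mul_assoc]
      _ = (b * a).coeff g⁻¹ := by rw [of_apply, coeff_single_mul_apply, one_mul, mul_one]
      _ = (antipode K (b * a)).coeff g := (coeff_antipode _ _).symm
      _ = (a * b).coeff g := by rw [antipode_mul_antidistrib, ha, hb]
  rw [mul_mul_eq_coeff_one_smul hone hab, hcoeff]

theorem leftIdealTrace_span_mul_left [Finite G] {r : K} (haa : a * a = r • a)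
    (hone : (a * b).coeff 1 = 1) (hab : ∀ x, ∃ k : K, a * x * b = k • (a * b)) :
    leftIdealTrace K (Ideal.span {a * b}) a = r := by
  have hfin : Module.Finite K (MonoidAlgebra K G) := .of_basis (MonoidAlgebra.basis G K)
  let f : MonoidAlgebra K G →ₗ[K] K :=
    { toFun := fun v => (a * v).coeff 1
      map_add' := fun v w => by simp [mul_add]
      map_smul' := fun t v => by simp }
  rw [leftIdealTrace_eq_of_rank_one (I := Ideal.span {a * b}) f
    ⟨a * b, Ideal.subset_span rfl⟩]
  · change (a * (a * b)).coeff 1 = r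
    rw [← mul_assoc, haa, smul_mul_assoc, coeff_smul_apply, hone, smul_eq_mul, mul_one]
  · intro v hv
    obtain ⟨y, rfl⟩ := Ideal.mem_span_singleton'.1 hv
    have := mul_mul_eq_coeff_one_smul hone hab (y * a)
    simpa only [f, LinearMap.coe_mk, AddHom.coe_mk, mul_assoc] using this

/-- Both sides come from `∑ h, (a h b) (a h b)`: each factor `a h b` is the `h`-th coefficient of
`a b` times `a b`, whereas `∑ h, h (b a) h` is `a b` times the sum of the squares. -/
theorem mul_mul_sumSquares [Fintype G] {r s : K} (hr : r ≠ 0) (hs : s ≠ 0) (haa : a * a = r • a)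
    (hbb : b * b = s • b) (ha : antipode K a = a) (hb : antipode K b = b)
    (hone : (a * b).coeff 1 = 1) (hab : ∀ x, ∃ k : K, a * x * b = k • (a * b)) :
    a * b * sumSquares K G = a * b * (a * b) := by
  have haabb : a * (a * b) * b = (r * s) • (a * b) := by
    rw [← mul_assoc, haa, mul_assoc, hbb, smul_mul_smul_comm]
  have h₁ : ∑ h, a * of K G h * b * (a * of K G h * b) = (r * s) • (a * b * (a * b)) := by
    calc ∑ h, a * of K G h * b * (a * of K G h * b)
        = ∑ h, a * b * (a * ((a * b).coeff h • of K G h) * b) := by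
          refine sum_congr rfl fun h _ => ?_
          conv_lhs => enter [1]; rw [mul_of_mul_eq_coeff_smul ha hb hone hab]
          simp only [smul_mul_assoc, mul_smul_comm]
      _ = a * b * (a * (a * b) * b) := by
          rw [← mul_sum, ← sum_mul, ← mul_sum, sum_coeff_smul_of]
      _ = (r * s) • (a * b * (a * b)) := by rw [haabb, mul_smul_comm]
  have h₂ : ∑ h, a * of K G h * b * (a * of K G h * b) =
      (r * s) • (a * b * sumSquares K G) := by
    calc ∑ h, a * of K G h * b * (a * of K G h * b)
        = a * (∑ h, of K G h * (b * a) * of K G h) * b := by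
          rw [mul_sum, sum_mul]
          exact sum_congr rfl fun h _ => by simp only [mul_assoc]
      _ = a * (a * b) * b * sumSquares K G := by
          rw [sum_of_mul_mul_of, antipode_mul_antidistrib, ha, hb, ← mul_assoc, mul_assoc,
            ← (commute_sumSquares b).eq, ← mul_assoc]
      _ = (r * s) • (a * b * sumSquares K G) := by rw [haabb, smul_mul_assoc]
  exact smul_right_injective _ (mul_ne_zero hr hs) (h₂.symm.trans h₁)

theorem leftIdealTrace_sumSquares [Fintype G] {r s : K} (hr : r ≠ 0) (hs : s ≠ 0)
    (haa : a * a = r • a) (hbb : b * b = s • b) (ha : antipode K a = a) (hb : antipode K b = b)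
    (hone : (a * b).coeff 1 = 1) (hab : ∀ x, ∃ k : K, a * x * b = k • (a * b)) :
    leftIdealTrace K (Ideal.span {a * b}) (sumSquares K G) = Fintype.card G := by
  have hfin : Module.Finite K (MonoidAlgebra K G) := .of_basis (MonoidAlgebra.basis G K)
  rw [leftIdealTrace_span_eq_trace_mulRight, trace_mulRight, hone, mul_one]
  intro v hv
  obtain ⟨y, rfl⟩ := Ideal.mem_span_singleton'.1 hv
  rw [← (commute_sumSquares _).eq, mul_assoc, mul_mul_sumSquares hr hs haa hbb ha hb hone hab]
  simp only [mul_assoc]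

end PrimitivePair

section TwistedSum

variable {G : Type*} [Group G] (K : Type*) [CommRing K] (H H' : Subgroup G) [Fintype H]
  [Fintype H'] (ε ε' : G →* ℤˣ)

/-- The sum of the elements of a subgroup `H`, twisted by a linear character with values `±1`.
Row symmetrizers and column antisymmetrizers are both of this form. -/
noncomputable def twistedSum : MonoidAlgebra K G := ∑ h : H, ((ε h : ℤ) : K) • of K G h

variable {H H'}

theorem intCast_unit_mul_self (u : ℤˣ) : ((u : ℤ) : K) * ((u : ℤ) : K) = 1 := by
  rw [← Int.cast_mul, ← Units.val_mul, Int.units_mul_self, Units.val_one, Int.cast_one]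

theorem of_mul_twistedSum {g : G} (hg : g ∈ H) :
    of K G g * twistedSum K H ε = ((ε g : ℤ) : K) • twistedSum K H ε := by
  rw [twistedSum, mul_sum, smul_sum]
  refine sum_equiv (Equiv.mulLeft (⟨g, hg⟩ : H)) (by simp) fun h _ => ?_
  change _ = ((ε g : ℤ) : K) • ((ε (g * h) : ℤ) : K) • of K G (g * h)
  rw [mul_smul_comm, ← map_mul (of K G), smul_smul, map_mul ε, Units.val_mul, Int.cast_mul,
    ← mul_assoc, intCast_unit_mul_self, one_mul]

theorem antipode_twistedSum : antipode K (twistedSum K H ε) = twistedSum K H ε := by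
  rw [twistedSum, map_sum]
  refine sum_equiv (Equiv.inv H) (by simp) fun h _ => ?_
  rw [map_smul, antipode_of, Equiv.inv_apply, InvMemClass.coe_inv, map_inv ε,
    Int.units_inv_eq_self]

theorem twistedSum_mul_of {g : G} (hg : g ∈ H) :
    twistedSum K H ε * of K G g = ((ε g : ℤ) : K) • twistedSum K H ε := by
  rw [← antipode_antipode (twistedSum K H ε * of K G g), antipode_mul_antidistrib, antipode_of,
    antipode_twistedSum, of_mul_twistedSum K ε (H.inv_mem hg), map_smul, antipode_twistedSum,
    map_inv ε, Int.units_inv_eq_self]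

theorem twistedSum_mul_self :
    twistedSum K H ε * twistedSum K H ε = (Fintype.card H : K) • twistedSum K H ε := by
  conv_lhs => enter [1]; rw [twistedSum]
  rw [sum_mul, sum_congr rfl fun h _ => by
    rw [smul_mul_assoc, of_mul_twistedSum K ε h.2, smul_smul, intCast_unit_mul_self, one_smul],
    sum_const, card_univ, Nat.cast_smul_eq_nsmul]

theorem coeff_one_twistedSum_mul (h : Disjoint H H') :
    (twistedSum K H ε * twistedSum K H' ε').coeff 1 = 1 := by
  classical
  rw [twistedSum, twistedSum, sum_mul_sum, ← sum_product', coeff_sum, Finset.sum_apply',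
    sum_eq_single (1, 1)]
  · simp
  · rintro ⟨p, q⟩ - hpq
    have hne : (p * q : G) ≠ 1 := fun hpq' => hpq <| by
      simpa using (Subgroup.disjoint_iff_mul_eq_one.1 h p.2 q.2 hpq')
    rw [smul_mul_smul_comm, ← map_mul, coeff_smul_apply, of_apply, coeff_single,
      Finsupp.single_eq_of_ne hne.symm, smul_zero]
  · simp

theorem twistedSum_mul_of_mul_twistedSum {p q : G} (hp : p ∈ H) (hq : q ∈ H') :
    twistedSum K H ε * of K G (p * q) * twistedSum K H' ε' =
      (((ε p : ℤ) : K) * (ε' q : ℤ)) • (twistedSum K H ε * twistedSum K H' ε') := by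
  rw [map_mul, ← mul_assoc, twistedSum_mul_of K ε hp, mul_assoc, of_mul_twistedSum K ε' hq,
    smul_mul_smul_comm]

theorem twistedSum_mul_of_mul_twistedSum_eq_zero [NoZeroDivisors K] [NeZero (2 : K)] {g t : G}
    (ht : t ∈ H) (htg : g⁻¹ * t * g ∈ H') (hε : ε t = 1) (hε' : ε' (g⁻¹ * t * g) = -1) :
    twistedSum K H ε * of K G g * twistedSum K H' ε' = 0 := by
  have hneg : twistedSum K H ε * of K G g * twistedSum K H' ε' =
      -(twistedSum K H ε * of K G g * twistedSum K H' ε') := by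
    calc twistedSum K H ε * of K G g * twistedSum K H' ε'
        = twistedSum K H ε * of K G t * of K G g * twistedSum K H' ε' := by
          rw [twistedSum_mul_of K ε ht, hε, Units.val_one, Int.cast_one, one_smul]
      _ = twistedSum K H ε * of K G g * (of K G (g⁻¹ * t * g) * twistedSum K H' ε') := by
          simp only [mul_assoc, ← map_mul]
          simp only [← mul_assoc, ← map_mul, mul_inv_cancel, one_mul]
      _ = -(twistedSum K H ε * of K G g * twistedSum K H' ε') := by
          rw [of_mul_twistedSum K ε' htg, hε', mul_smul_comm]
          simp
  have htwo : (2 : K) • (twistedSum K H ε * of K G g * twistedSum K H' ε') = 0 := by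
    rw [two_smul]
    exact add_eq_zero_iff_eq_neg.2 hneg
  ext g
  have := congrArg (fun x => x.coeff g) htwo
  simpa [two_ne_zero] using this

end TwistedSum

section Tableaux

variable {α : Type*} {μ ν : YoungDiagram}

/-- The number of cells in the first `m` columns of a Young diagram. Comparing these numbers for
all `m` is the reversed dominance order. -/
def colWeight (μ : YoungDiagram) (m : ℕ) : ℕ := #{c ∈ μ.cells | c.2 < m}

theorem card_filter_equiv_cells [Fintype α] (T : α ≃ μ.cells) (P : ℕ × ℕ → Prop) [DecidablePred P] :
    #{i | P (T i)} = #{c ∈ μ.cells | P c} := by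
  have hcells : μ.cells = univ.map (T.toEmbedding.trans (.subtype _)) := by
    ext c
    simp only [mem_map, mem_univ, true_and, Function.Embedding.trans_apply,
      Equiv.coe_toEmbedding, Function.Embedding.subtype_apply]
    exact ⟨fun hc => ⟨T.symm ⟨c, hc⟩, by simp⟩, by rintro ⟨i, rfl⟩; exact (T i).2⟩
  conv_rhs => rw [hcells, filter_map, card_map]
  rfl

theorem card_fst_eq_and_snd_lt [Fintype α] (T : α ≃ μ.cells) (k m : ℕ) :
    #{i | (T i : ℕ × ℕ).1 = k ∧ (T i : ℕ × ℕ).2 < m} = min (μ.rowLen k) m := by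
  rw [card_filter_equiv_cells T fun c => c.1 = k ∧ c.2 < m]
  have hrow : {c ∈ μ.cells | c.1 = k ∧ c.2 < m} = {k} ×ˢ range (min (μ.rowLen k) m) := by
    ext ⟨i, j⟩
    simp only [mem_filter, YoungDiagram.mem_cells, YoungDiagram.mem_iff_lt_rowLen, mem_product,
      mem_singleton, mem_range, lt_min_iff]
    constructor
    · rintro ⟨h, rfl, h'⟩
      exact ⟨rfl, h, h'⟩
    · rintro ⟨rfl, h, h'⟩
      exact ⟨h, rfl, h'⟩
  rw [hrow, card_product, card_singleton, card_range, one_mul]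

theorem card_fst_eq [Fintype α] (T : α ≃ μ.cells) (k : ℕ) :
    #{i | (T i : ℕ × ℕ).1 = k} = μ.rowLen k := by
  rw [card_filter_equiv_cells T fun c => c.1 = k, YoungDiagram.rowLen_eq_card, YoungDiagram.row]

theorem card_snd_eq [Fintype α] (T : α ≃ μ.cells) (k : ℕ) :
    #{i | (T i : ℕ × ℕ).2 = k} = μ.colLen k := by
  rw [card_filter_equiv_cells T fun c => c.2 = k, YoungDiagram.colLen_eq_card, YoungDiagram.col]

theorem colWeight_succ (μ : YoungDiagram) (m : ℕ) :
    colWeight μ (m + 1) = colWeight μ m + μ.colLen m := by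
  rw [colWeight, colWeight, YoungDiagram.colLen_eq_card, YoungDiagram.col,
    ← card_union_of_disjoint (disjoint_filter.2 fun c _ h => h.ne), ← filter_or]
  simp only [Nat.lt_succ_iff, le_iff_lt_or_eq]

theorem colWeight_injective : Function.Injective colWeight := by
  intro μ ν h
  ext ⟨i, j⟩
  have hμ := colWeight_succ μ j
  have hν := colWeight_succ ν j
  rw [h] at hμ
  rw [YoungDiagram.mem_cells, YoungDiagram.mem_cells, YoungDiagram.mem_iff_lt_colLen,
    YoungDiagram.mem_iff_lt_colLen]
  omega

theorem card_fst_eq_and_snd_lt_le [Fintype α] {S : α ≃ ν.cells} {T : α ≃ μ.cells}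
    (h : Function.Injective fun i => ((S i : ℕ × ℕ).1, (T i : ℕ × ℕ).2)) (k m : ℕ) :
    #{i | (S i : ℕ × ℕ).1 = k ∧ (T i : ℕ × ℕ).2 < m} ≤ min (ν.rowLen k) m := by
  refine le_min ?_ ?_
  · rw [← card_fst_eq S]
    exact card_le_card (monotone_filter_right _ fun _ _ hi => hi.1)
  · rw [← card_range m]
    refine card_le_card_of_injOn (fun i => (T i : ℕ × ℕ).2) (fun i hi => ?_)
      fun i hi j hj hij => h (Prod.ext ?_ hij)
    · simpa using (mem_filter.1 hi).2.2
    · exact (mem_filter.1 hi).2.1.trans (mem_filter.1 hj).2.1.symm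

theorem colWeight_eq_sum_card_fst_eq [Fintype α] (S : α ≃ ν.cells) (T : α ≃ μ.cells) (m : ℕ) :
    colWeight μ m = ∑ k ∈ univ.image fun i => (S i : ℕ × ℕ).1,
      #{i | (S i : ℕ × ℕ).1 = k ∧ (T i : ℕ × ℕ).2 < m} := by
  rw [colWeight, ← card_filter_equiv_cells T fun c => c.2 < m,
    card_eq_sum_card_fiberwise fun i _ => mem_image_of_mem (fun i => (S i : ℕ × ℕ).1) (mem_univ i)]
  simp only [filter_filter, and_comm]

theorem colWeight_le_of_injective {S : α ≃ ν.cells} {T : α ≃ μ.cells}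
    (h : Function.Injective fun i => ((S i : ℕ × ℕ).1, (T i : ℕ × ℕ).2)) :
    colWeight μ ≤ colWeight ν := fun m => by
  have : Fintype α := .ofEquiv _ S.symm
  rw [colWeight_eq_sum_card_fst_eq S T, colWeight_eq_sum_card_fst_eq S S]
  refine sum_le_sum fun k _ => ?_
  rw [card_fst_eq_and_snd_lt]
  exact card_fst_eq_and_snd_lt_le h k m

theorem snd_lt_rowLen_fst_of_injective {S T : α ≃ μ.cells}
    (h : Function.Injective fun i => ((S i : ℕ × ℕ).1, (T i : ℕ × ℕ).2)) (i : α) :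
    (T i : ℕ × ℕ).2 < μ.rowLen (S i : ℕ × ℕ).1 := by
  have : Fintype α := .ofEquiv _ S.symm
  set m := μ.rowLen (S i : ℕ × ℕ).1 with hm
  have hsum := (colWeight_eq_sum_card_fst_eq S T m).symm.trans (colWeight_eq_sum_card_fst_eq S S m)
  have hle (k : ℕ) : #{i | (S i : ℕ × ℕ).1 = k ∧ (T i : ℕ × ℕ).2 < m} ≤
      #{i | (S i : ℕ × ℕ).1 = k ∧ (S i : ℕ × ℕ).2 < m} := by
    rw [card_fst_eq_and_snd_lt]
    exact card_fst_eq_and_snd_lt_le h k m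
  have hcard := (sum_eq_sum_iff_of_le fun k _ => hle k).1 hsum (S i : ℕ × ℕ).1
    (mem_image_of_mem (fun i => (S i : ℕ × ℕ).1) (mem_univ i))
  rw [card_fst_eq_and_snd_lt, ← hm, min_self, hm, ← card_fst_eq S, ← filter_filter,
    card_filter_eq_iff] at hcard
  rw [hm, ← card_fst_eq S]
  exact hcard i (by simp)

theorem exists_perm_fst_eq_snd_eq {S T : α ≃ μ.cells}
    (h : Function.Injective fun i => ((S i : ℕ × ℕ).1, (T i : ℕ × ℕ).2)) :
    ∃ p : Equiv.Perm α, ∀ i, (S (p i) : ℕ × ℕ) = ((S i : ℕ × ℕ).1, (T i : ℕ × ℕ).2) := by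
  have hmem (i : α) : ((S i : ℕ × ℕ).1, (T i : ℕ × ℕ).2) ∈ μ.cells :=
    (YoungDiagram.mem_cells _).2
      (YoungDiagram.mem_iff_lt_rowLen.2 (snd_lt_rowLen_fst_of_injective h i))
  have hinj : Function.Injective fun i => S.symm ⟨_, hmem i⟩ := fun i j hij =>
    h (congrArg Subtype.val (S.symm.injective hij))
  have : Finite α := .of_equiv _ S.symm
  exact ⟨Equiv.ofBijective _ (Finite.injective_iff_bijective.1 hinj), fun i => by simp⟩

end Tableaux

section FiberSubgroup

variable {α ι : Type*} {f : α → ι}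

/-- The permutations preserving the fibres of `f`: the row and column stabilizers of a tableau. -/
def fiberSubgroup (f : α → ι) : Subgroup (Equiv.Perm α) where
  carrier := {σ | ∀ i, f (σ i) = f i}
  one_mem' _ := rfl
  mul_mem' hσ hτ i := (hσ _).trans (hτ i)
  inv_mem' {σ} hσ i := by simpa using (hσ (σ⁻¹ i)).symm

theorem mem_fiberSubgroup {σ : Equiv.Perm α} : σ ∈ fiberSubgroup f ↔ ∀ i, f (σ i) = f i := Iff.rfl

instance [Fintype α] [DecidableEq ι] : DecidablePred (· ∈ fiberSubgroup f) := fun σ =>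
  decidable_of_iff (∀ i, f (σ i) = f i) Iff.rfl

theorem swap_mem_fiberSubgroup [DecidableEq α] {i j : α} (h : f i = f j) :
    Equiv.swap i j ∈ fiberSubgroup f :=
  Equiv.apply_swap_eq_self h

theorem disjoint_fiberSubgroup {κ : Type*} {g : α → κ}
    (h : Function.Injective fun i => (f i, g i)) :
    Disjoint (fiberSubgroup f) (fiberSubgroup g) := by
  rw [Subgroup.disjoint_def]
  exact fun hf hg => Equiv.ext fun i => h (Prod.ext (hf i) (hg i))

theorem twistedSum_fiberSubgroup [Fintype (Equiv.Perm α)] [Fintype (fiberSubgroup f)]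
    [DecidablePred fun σ : Equiv.Perm α => ∀ i, f (σ i) = f i] (K : Type*) [CommRing K]
    (ε : Equiv.Perm α →* ℤˣ) :
    twistedSum K (fiberSubgroup f) ε =
      ∑ σ : Equiv.Perm α with ∀ i, f (σ i) = f i, ((ε σ : ℤ) : K) • of K _ σ :=
  (sum_subtype _ (fun σ => by simp [mem_fiberSubgroup])
    fun σ => ((ε σ : ℤ) : K) • of K _ σ).symm

end FiberSubgroup

section YoungSymmetrizer

variable {n : ℕ} (lam nu : Nat.Partition n)

theorem rowSymmetrizer_eq_twistedSum :
    rowSymmetrizer lam = twistedSum ℂ (fiberSubgroup (rowOf lam)) 1 := by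
  simp [rowSymmetrizer, twistedSum_fiberSubgroup]

theorem colAntisymmetrizer_eq_twistedSum :
    colAntisymmetrizer lam = twistedSum ℂ (fiberSubgroup (colOf lam)) Equiv.Perm.sign :=
  (twistedSum_fiberSubgroup ℂ _).symm

theorem antipode_rowSymmetrizer : antipode ℂ (rowSymmetrizer lam) = rowSymmetrizer lam := by
  rw [rowSymmetrizer_eq_twistedSum, antipode_twistedSum]

theorem antipode_colAntisymmetrizer :
    antipode ℂ (colAntisymmetrizer lam) = colAntisymmetrizer lam := by
  rw [colAntisymmetrizer_eq_twistedSum, antipode_twistedSum]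

theorem rowSymmetrizer_mul_self : rowSymmetrizer lam * rowSymmetrizer lam =
    (Fintype.card (fiberSubgroup (rowOf lam)) : ℂ) • rowSymmetrizer lam := by
  rw [rowSymmetrizer_eq_twistedSum, twistedSum_mul_self]

theorem colAntisymmetrizer_mul_self : colAntisymmetrizer lam * colAntisymmetrizer lam =
    (Fintype.card (fiberSubgroup (colOf lam)) : ℂ) • colAntisymmetrizer lam := by
  rw [colAntisymmetrizer_eq_twistedSum, twistedSum_mul_self]

theorem coeff_one_row_mul_col : (rowSymmetrizer lam * colAntisymmetrizer lam).coeff 1 = 1 := by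
  rw [rowSymmetrizer_eq_twistedSum, colAntisymmetrizer_eq_twistedSum]
  refine coeff_one_twistedSum_mul _ _ _ (disjoint_fiberSubgroup fun i j hij => ?_)
  exact (tableau lam).symm.injective (Subtype.ext hij)

variable {lam nu}

theorem row_mul_of_mul_col_eq_zero {g : Equiv.Perm (Fin n)}
    (h : ¬ Function.Injective fun i => (rowOf nu i, colOf lam (g⁻¹ i))) :
    rowSymmetrizer nu * of ℂ _ g * colAntisymmetrizer lam = 0 := by
  obtain ⟨i, j, hij, hne⟩ := Function.not_injective_iff.1 h
  obtain ⟨hrow, hcol⟩ := Prod.ext_iff.1 hij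
  have hconj : g⁻¹ * Equiv.swap i j * g = Equiv.swap (g⁻¹ i) (g⁻¹ j) := by
    rw [Equiv.swap_apply_apply, inv_inv]
  rw [rowSymmetrizer_eq_twistedSum, colAntisymmetrizer_eq_twistedSum]
  refine twistedSum_mul_of_mul_twistedSum_eq_zero ℂ _ _
    (swap_mem_fiberSubgroup hrow) ?_ rfl ?_
  · rw [hconj]
    exact swap_mem_fiberSubgroup hcol
  · rw [hconj, Equiv.Perm.sign_swap (g⁻¹.injective.ne hne)]

theorem row_mul_mul_col_eq_zero (h : ¬ colWeight (diagram lam) ≤ colWeight (diagram nu))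
    (x : MonoidAlgebra ℂ (Equiv.Perm (Fin n))) :
    rowSymmetrizer nu * x * colAntisymmetrizer lam = 0 := by
  rw [← sum_coeff_smul_of x, mul_sum, sum_mul]
  refine sum_eq_zero fun g _ => ?_
  rw [mul_smul_comm, smul_mul_assoc, row_mul_of_mul_col_eq_zero, smul_zero]
  exact fun hinj => h (colWeight_le_of_injective (S := (tableau nu).symm)
    (T := (g⁻¹).trans (tableau lam).symm) hinj)

theorem col_mul_mul_row_eq_zero (h : ¬ colWeight (diagram nu) ≤ colWeight (diagram lam))
    (x : MonoidAlgebra ℂ (Equiv.Perm (Fin n))) :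
    colAntisymmetrizer nu * x * rowSymmetrizer lam = 0 := by
  rw [← antipode_antipode (colAntisymmetrizer nu * x * rowSymmetrizer lam),
    antipode_mul_antidistrib, antipode_mul_antidistrib (a := colAntisymmetrizer nu),
    antipode_rowSymmetrizer, antipode_colAntisymmetrizer, ← mul_assoc, row_mul_mul_col_eq_zero h,
    map_zero]

variable (lam) in
theorem exists_row_mul_of_mul_col_eq_smul (g : Equiv.Perm (Fin n)) :
    ∃ k : ℂ, rowSymmetrizer lam * of ℂ _ g * colAntisymmetrizer lam =
      k • (rowSymmetrizer lam * colAntisymmetrizer lam) := by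
  by_cases hinj : Function.Injective fun i => (rowOf lam i, colOf lam (g⁻¹ i))
  · obtain ⟨p, hp⟩ := exists_perm_fst_eq_snd_eq (S := (tableau lam).symm)
      (T := (g⁻¹).trans (tableau lam).symm) hinj
    have hrow : p ∈ fiberSubgroup (rowOf lam) := fun i => (Prod.ext_iff.1 (hp i)).1
    have hcol : p * g ∈ fiberSubgroup (colOf lam) := fun i =>
      (Prod.ext_iff.1 (hp (g i))).2.trans (congrArg (colOf lam) (g.symm_apply_apply i))
    rw [← inv_mul_cancel_left p g, rowSymmetrizer_eq_twistedSum, colAntisymmetrizer_eq_twistedSum,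
      twistedSum_mul_of_mul_twistedSum ℂ _ _ (inv_mem hrow) hcol]
    exact ⟨_, rfl⟩
  · exact ⟨0, by rw [row_mul_of_mul_col_eq_zero hinj, zero_smul]⟩

variable (lam) in
theorem exists_row_mul_mul_col_eq_smul (x : MonoidAlgebra ℂ (Equiv.Perm (Fin n))) :
    ∃ k : ℂ, rowSymmetrizer lam * x * colAntisymmetrizer lam =
      k • (rowSymmetrizer lam * colAntisymmetrizer lam) := by
  choose k hk using exists_row_mul_of_mul_col_eq_smul lam
  refine ⟨∑ g, x.coeff g * k g, ?_⟩
  conv_lhs => rw [← sum_coeff_smul_of x, mul_sum, sum_mul]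
  simp only [mul_smul_comm, smul_mul_assoc, hk, smul_smul, sum_smul]

end YoungSymmetrizer

section SpechtTrace

variable {n : ℕ} (lam : Nat.Partition n) {nu : Nat.Partition n}

/-- The character of the Specht module of `lam`, extended linearly to the group algebra. -/
noncomputable def spechtTrace : MonoidAlgebra ℂ (Equiv.Perm (Fin n)) →ₗ[ℂ] ℂ :=
  leftIdealTrace ℂ (spechtModule lam)

theorem spechtTrace_of (g : Equiv.Perm (Fin n)) :
    spechtTrace lam (of ℂ _ g) = (spechtRep lam).character g := rfl

theorem spechtTrace_rowSymmetrizer (nu : Nat.Partition n) : spechtTrace lam (rowSymmetrizer nu) =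
    ∑ σ : Equiv.Perm (Fin n) with ∀ i, rowOf nu (σ i) = rowOf nu i,
      (spechtRep lam).character σ := by
  simp only [rowSymmetrizer, map_sum, spechtTrace_of]

theorem spechtTrace_colAntisymmetrizer (nu : Nat.Partition n) :
    spechtTrace lam (colAntisymmetrizer nu) =
      ∑ σ : Equiv.Perm (Fin n) with ∀ i, colOf nu (σ i) = colOf nu i,
        ((Equiv.Perm.sign σ : ℤ) : ℂ) * (spechtRep lam).character σ := by
  simp only [colAntisymmetrizer, map_sum, map_smul, spechtTrace_of, smul_eq_mul]

variable {lam}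

theorem spechtTrace_eq_zero {x : MonoidAlgebra ℂ (Equiv.Perm (Fin n))}
    (h : ∀ y, x * y * rowSymmetrizer lam * colAntisymmetrizer lam = 0) :
    spechtTrace lam x = 0 := by
  refine leftIdealTrace_eq_zero fun v hv => ?_
  obtain ⟨y, rfl⟩ := Ideal.mem_span_singleton'.1 hv
  rw [← mul_assoc, ← mul_assoc, h]

theorem spechtTrace_rowSymmetrizer_eq_zero
    (h : ¬ colWeight (diagram lam) ≤ colWeight (diagram nu)) :
    spechtTrace lam (rowSymmetrizer nu) = 0 :=
  spechtTrace_eq_zero fun y => by rw [mul_assoc (rowSymmetrizer nu), row_mul_mul_col_eq_zero h]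

theorem spechtTrace_colAntisymmetrizer_eq_zero
    (h : ¬ colWeight (diagram nu) ≤ colWeight (diagram lam)) :
    spechtTrace lam (colAntisymmetrizer nu) = 0 :=
  spechtTrace_eq_zero fun y => by rw [col_mul_mul_row_eq_zero h, zero_mul]

variable (lam)

theorem spechtTrace_rowSymmetrizer_self :
    spechtTrace lam (rowSymmetrizer lam) = Fintype.card (fiberSubgroup (rowOf lam)) :=
  leftIdealTrace_span_mul_left (rowSymmetrizer_mul_self lam) (coeff_one_row_mul_col lam)
    (exists_row_mul_mul_col_eq_smul lam)

theorem sum_character_sq :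
    ∑ h : Equiv.Perm (Fin n), (spechtRep lam).character (h * h) = n.factorial := by
  have htrace := leftIdealTrace_sumSquares (Nat.cast_ne_zero.2 Fintype.card_ne_zero)
    (Nat.cast_ne_zero.2 Fintype.card_ne_zero) (rowSymmetrizer_mul_self lam)
    (colAntisymmetrizer_mul_self lam) (antipode_rowSymmetrizer lam)
    (antipode_colAntisymmetrizer lam) (coeff_one_row_mul_col lam)
    (exists_row_mul_mul_col_eq_smul lam)
  rw [sumSquares, map_sum, Fintype.card_perm, Fintype.card_fin] at htrace
  exact htrace

end SpechtTrace

end SchurMult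

namespace SchurMult

open Finset Equiv.Perm

section CentralizerOrder

theorem zee_eq_prod {m : Multiset ℕ} {s : Finset ℕ} (hs : m.toFinset ⊆ s) :
    zee m = ∏ i ∈ s, (m.count i).factorial * i ^ m.count i := by
  refine prod_subset hs fun i _ hi => ?_
  rw [Multiset.mem_toFinset, ← Multiset.count_eq_zero] at hi
  rw [hi, Nat.factorial_zero, pow_zero, mul_one]

theorem zee_cons (a : ℕ) (m : Multiset ℕ) :
    zee (a ::ₘ m) = a * (m.count a + 1) * zee m := by
  have hcons : (a ::ₘ m).toFinset ⊆ insert a m.toFinset := by rw [Multiset.toFinset_cons]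
  rw [zee_eq_prod hcons, zee_eq_prod (subset_insert a m.toFinset),
    ← mul_prod_erase _ _ (mem_insert_self a _),
    ← mul_prod_erase _ (fun i => (m.count i).factorial * i ^ m.count i) (mem_insert_self a _),
    prod_congr (g := fun i => (m.count i).factorial * i ^ m.count i) rfl fun i hi => by
      rw [Multiset.count_cons_of_ne (ne_of_mem_erase hi)],
    Multiset.count_cons_self, Nat.factorial_succ, pow_succ]
  ring

theorem zee_add_replicate {a : ℕ} {m : Multiset ℕ} (ha : a ∉ m) (k : ℕ) :
    zee (m + Multiset.replicate k a) = k.factorial * a ^ k * zee m := by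
  induction k with
  | zero => simp
  | succ k ih =>
    rw [Multiset.replicate_succ, Multiset.add_cons, zee_cons, ih, Multiset.count_add,
      Multiset.count_eq_zero.2 ha, Multiset.count_replicate_self, Nat.factorial_succ, pow_succ]
    ring

theorem zee_ne_zero {m : Multiset ℕ} (hm : ∀ i ∈ m, 0 < i) : zee m ≠ 0 :=
  prod_ne_zero_iff.2 fun i hi =>
    mul_ne_zero (Nat.factorial_ne_zero _) (pow_ne_zero _ (hm i (Multiset.mem_toFinset.1 hi)).ne')

theorem zee_parts_ne_zero {n : ℕ} (π : Nat.Partition n) : zee π.parts ≠ 0 :=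
  zee_ne_zero fun _ hi => π.parts_pos hi

end CentralizerOrder

section CycleExp

variable {R : Type*} [CommRing R]

theorem mk_neg_pow_mul_one_add (y : R) :
    (PowerSeries.mk fun k => (-y) ^ k) * (1 + PowerSeries.C y * PowerSeries.X) = 1 := by
  ext k
  rw [mul_add, mul_one, ← mul_assoc, mul_right_comm, mul_comm _ (PowerSeries.C y)]
  cases k with
  | zero => simp
  | succ k =>
    rw [map_add, PowerSeries.coeff_C_mul, PowerSeries.coeff_succ_mul_X]
    simp [PowerSeries.coeff_one, pow_succ, mul_comm]

variable [Algebra ℚ R]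

/-- The cycle index of the symmetric group `S_n` at the variables `P 1, P 2, …`: the sum of
`z_π⁻¹ ∏ P π_i` over the partitions `π` of `n`. -/
noncomputable def cycleExp (P : ℕ → R) (n : ℕ) : R :=
  ∑ π : Nat.Partition n, (zee π.parts : ℚ)⁻¹ • (π.parts.map P).prod

theorem cycleExp_zero (P : ℕ → R) : cycleExp P 0 = 1 := by
  rw [cycleExp, Fintype.sum_unique]
  simp [zee]

theorem sum_mul_count_parts {n : ℕ} (π : Nat.Partition n) :
    ∑ a ∈ Icc 1 n, a * π.parts.count a = n := by
  conv_rhs => rw [← π.parts_sum, sum_multiset_count]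
  symm
  refine (sum_subset (fun a ha => ?_) fun a _ ha => ?_).trans
    (sum_congr rfl fun a _ => by rw [smul_eq_mul, mul_comm])
  · rw [Multiset.mem_toFinset] at ha
    exact mem_Icc.2 ⟨π.parts_pos ha, Nat.Partition.le_of_mem_parts ha⟩
  · rw [Multiset.mem_toFinset, ← Multiset.count_eq_zero] at ha
    rw [ha, zero_smul]

theorem sum_mul_count_smul_prod_parts (P : ℕ → R) {a n : ℕ} (ha : 1 ≤ a) (han : a ≤ n) :
    ∑ π : Nat.Partition n, ((a * π.parts.count a : ℕ) * (zee π.parts : ℚ)⁻¹) •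
      (π.parts.map P).prod = P a * cycleExp P (n - a) := by
  rw [← sum_filter_of_ne (p := fun π : Nat.Partition n => a ∈ π.parts), cycleExp, mul_sum,
    sum_subtype _ (p := fun π : Nat.Partition n => a ∈ π.parts) (by simp)]
  · refine Fintype.sum_equiv (Nat.Partition.partitionWithPartEquiv ha han) _ _ fun π => ?_
    rw [Nat.Partition.partitionWithPartEquiv_apply_parts]
    obtain ⟨m, hm⟩ := Multiset.exists_cons_of_mem π.2
    have hpos (i : ℕ) (hi : i ∈ m) : 0 < i :=
      π.1.parts_pos (hm ▸ Multiset.mem_cons_of_mem hi)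
    have ha₀ : (a : ℚ) ≠ 0 := Nat.cast_ne_zero.2 (Nat.one_le_iff_ne_zero.1 ha)
    have hcount : ((m.count a : ℚ) + 1) ≠ 0 := Nat.cast_add_one_ne_zero _
    have hzee : (zee m : ℚ) ≠ 0 := Nat.cast_ne_zero.2 (zee_ne_zero hpos)
    rw [hm, Multiset.erase_cons_head, zee_cons, Multiset.count_cons_self, Multiset.map_cons,
      Multiset.prod_cons, mul_smul_comm]
    congr 1
    push_cast
    field_simp
  · intro π _ hne
    by_contra hmem
    rw [← Multiset.count_eq_zero] at hmem
    exact hne (by rw [hmem, mul_zero, Nat.cast_zero, zero_mul, zero_smul])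

theorem natCast_mul_cycleExp (P : ℕ → R) (n : ℕ) :
    (n : R) * cycleExp P n = ∑ a ∈ Icc 1 n, P a * cycleExp P (n - a) := by
  calc (n : R) * cycleExp P n
      = ∑ a ∈ Icc 1 n, ∑ π : Nat.Partition n,
          ((a * π.parts.count a : ℕ) * (zee π.parts : ℚ)⁻¹) • (π.parts.map P).prod := by
        rw [← nsmul_eq_mul, ← Nat.cast_smul_eq_nsmul ℚ, cycleExp, smul_sum, sum_comm]
        refine sum_congr rfl fun π _ => ?_
        rw [← sum_smul, ← sum_mul, ← Nat.cast_sum, sum_mul_count_parts, smul_smul]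
    _ = ∑ a ∈ Icc 1 n, P a * cycleExp P (n - a) := sum_congr rfl fun a ha =>
        sum_mul_count_smul_prod_parts P (mem_Icc.1 ha).1 (mem_Icc.1 ha).2

/-- The generating function of `cycleExp P`, formally `exp (∑ P k * X ^ k / k)`. -/
noncomputable def expSeries (P : ℕ → R) : PowerSeries R := PowerSeries.mk (cycleExp P)

theorem coeff_expSeries (P : ℕ → R) (n : ℕ) :
    PowerSeries.coeff n (expSeries P) = cycleExp P n := PowerSeries.coeff_mk _ _

theorem derivative_expSeries (P : ℕ → R) :
    PowerSeries.derivative R (expSeries P) =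
      PowerSeries.mk (fun k => P (k + 1)) * expSeries P := by
  ext n
  rw [PowerSeries.coeff_derivative, PowerSeries.coeff_mul, coeff_expSeries, mul_comm,
    ← Nat.cast_succ, Nat.succ_eq_add_one, natCast_mul_cycleExp P (n + 1),
    Nat.sum_antidiagonal_eq_sum_range_succ_mk, range_eq_Ico,
    show Icc 1 (n + 1) = Ico (0 + 1) (n + 1 + 1) from rfl,
    ← sum_Ico_add' (fun a => P a * cycleExp P (n + 1 - a))]
  refine sum_congr rfl fun k _ => ?_
  rw [PowerSeries.coeff_mk, coeff_expSeries, Nat.add_sub_add_right]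

theorem eq_expSeries {P : ℕ → R} {f : PowerSeries R} (h₀ : PowerSeries.coeff 0 f = 1)
    (h : PowerSeries.derivative R f = PowerSeries.mk (fun k => P (k + 1)) * f) :
    f = expSeries P := by
  ext n
  induction n using Nat.strong_induction_on with
  | _ n ih =>
    cases n with
    | zero => rw [h₀, coeff_expSeries, cycleExp_zero]
    | succ n =>
      have hf := congrArg (PowerSeries.coeff n) h
      have hexp := congrArg (PowerSeries.coeff n) (derivative_expSeries P)
      rw [PowerSeries.coeff_derivative, PowerSeries.coeff_mul] at hf hexp
      have hunit : IsUnit ((n : R) + 1) := by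
        have : IsUnit ((n : ℚ) + 1) := IsUnit.mk0 _ (Nat.cast_add_one_ne_zero n)
        simpa using this.map (algebraMap ℚ R)
      refine hunit.mul_left_injective ?_
      change PowerSeries.coeff (n + 1) f * (n + 1) =
        PowerSeries.coeff (n + 1) (expSeries P) * (n + 1)
      rw [hf, hexp]
      refine sum_congr rfl fun p hp => ?_
      rw [ih p.2 (by have := mem_antidiagonal.1 hp; omega)]

theorem expSeries_add (P Q : ℕ → R) : expSeries (P + Q) = expSeries P * expSeries Q := by
  symm
  apply eq_expSeries
  · simp [PowerSeries.coeff_mul, coeff_expSeries, cycleExp_zero]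
  · have hadd : (PowerSeries.mk fun k => (P + Q) (k + 1)) =
        (PowerSeries.mk fun k => P (k + 1)) + PowerSeries.mk fun k => Q (k + 1) := by
      ext k
      simp
    rw [Derivation.leibniz, derivative_expSeries, derivative_expSeries, hadd, smul_eq_mul,
      smul_eq_mul]
    ring

theorem expSeries_zero : expSeries (0 : ℕ → R) = 1 := by
  symm
  apply eq_expSeries
  · exact PowerSeries.coeff_zero_one
  · have hzero : (PowerSeries.mk fun k => (0 : ℕ → R) (k + 1)) = 0 := by
      ext k
      simp
    rw [hzero, zero_mul, Derivation.map_one_eq_zero]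

theorem expSeries_sum {ι : Type*} (s : Finset ι) (P : ι → ℕ → R) :
    expSeries (∑ v ∈ s, P v) = ∏ v ∈ s, expSeries (P v) := by
  classical
  induction s using Finset.induction_on with
  | empty => rw [sum_empty, prod_empty, expSeries_zero]
  | insert v s hv ih => rw [sum_insert hv, prod_insert hv, expSeries_add, ih]

theorem expSeries_pow (y : R) : expSeries (fun k => y ^ k) = PowerSeries.mk fun k => y ^ k := by
  symm
  apply eq_expSeries
  · simp
  · ext n
    simp only [PowerSeries.coeff_derivative, PowerSeries.coeff_mul, PowerSeries.coeff_mk]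
    rw [sum_congr rfl fun p hp => by
      rw [← pow_add, add_right_comm, mem_antidiagonal.1 hp], sum_const, Nat.card_antidiagonal,
      nsmul_eq_mul, mul_comm, Nat.cast_succ]

theorem expSeries_neg_pow (y : R) :
    expSeries (fun k => -(-y) ^ k) = 1 + PowerSeries.C y * PowerSeries.X := by
  refine left_inv_eq_right_inv ?_ (mk_neg_pow_mul_one_add y)
  rw [← expSeries_pow, ← expSeries_add, ← expSeries_zero]
  exact congrArg expSeries (funext fun k => neg_add_cancel _)

end CycleExp

section ClassSize

theorem parts_eq_filter_add_replicate {n : ℕ} (π : Nat.Partition n) :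
    π.parts = π.parts.filter (2 ≤ ·) +
      Multiset.replicate (n - (π.parts.filter (2 ≤ ·)).sum) 1 := by
  have hsplit := Multiset.filter_add_not (2 ≤ ·) π.parts
  have hone : π.parts.filter (fun i => ¬ 2 ≤ i) =
      Multiset.replicate (π.parts.filter (fun i => ¬ 2 ≤ i)).card 1 := by
    rw [Multiset.eq_replicate_card]
    intro i hi
    rw [Multiset.mem_filter] at hi
    have := π.parts_pos hi.1
    omega
  have hsum := congrArg Multiset.sum hsplit
  rw [Multiset.sum_add, π.parts_sum, hone, Multiset.sum_replicate, smul_eq_mul, mul_one] at hsum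
  rw [show n - (π.parts.filter (2 ≤ ·)).sum = (π.parts.filter (fun i => ¬ 2 ≤ i)).card by omega,
    ← hone, hsplit]

theorem zee_parts {n : ℕ} (π : Nat.Partition n) :
    zee π.parts = (n - (π.parts.filter (2 ≤ ·)).sum).factorial * (π.parts.filter (2 ≤ ·)).prod *
      ∏ i ∈ (π.parts.filter (2 ≤ ·)).toFinset, ((π.parts.filter (2 ≤ ·)).count i).factorial := by
  conv_lhs => rw [parts_eq_filter_add_replicate π]
  rw [zee_add_replicate (by simp [Multiset.mem_filter]), one_pow, mul_one, mul_assoc, zee,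
    prod_mul_distrib, prod_multiset_count (π.parts.filter (2 ≤ ·)),
    mul_comm (∏ i ∈ _, Nat.factorial _)]

variable {α : Type*} [Fintype α] [DecidableEq α]

theorem partition_eq_iff_cycleType_eq (g : Equiv.Perm α) (π : Nat.Partition (Fintype.card α)) :
    g.partition = π ↔ g.cycleType = π.parts.filter (2 ≤ ·) := by
  constructor
  · rintro rfl
    exact filter_parts_partition_eq_cycleType.symm
  · intro h
    apply Nat.Partition.ext
    rw [parts_partition, ← sum_cycleType, h, ← parts_eq_filter_add_replicate]

theorem card_partition_eq_mul_zee (π : Nat.Partition (Fintype.card α)) :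
    #{g : Equiv.Perm α | g.partition = π} * zee π.parts = (Fintype.card α).factorial := by
  have hle : (π.parts.filter (2 ≤ ·)).sum ≤ Fintype.card α := by
    have hsum := congrArg Multiset.sum (Multiset.filter_add_not (2 ≤ ·) π.parts)
    rw [Multiset.sum_add, π.parts_sum] at hsum
    omega
  have hclass := card_of_cycleType_mul_eq α (π.parts.filter (2 ≤ ·))
  rw [if_pos ⟨hle, fun a ha => (Multiset.mem_filter.1 ha).2⟩, ← zee_parts] at hclass
  simpa only [partition_eq_iff_cycleType_eq] using hclass

variable {R : Type*} [CommRing R]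

/-- The product of `P` over the cycle lengths of a permutation, fixed points included: the power
sum attached to its cycle type, when `P k` is the `k`-th power sum. -/
def cycleProd (P : ℕ → R) (g : Equiv.Perm α) : R := (g.partition.parts.map P).prod

theorem sum_cycleProd [Algebra ℚ R] (P : ℕ → R) :
    ∑ g : Equiv.Perm α, cycleProd P g =
      (Fintype.card α).factorial * cycleExp P (Fintype.card α) := by
  rw [cycleExp, mul_sum, ← sum_fiberwise univ fun g : Equiv.Perm α => g.partition]
  refine sum_congr rfl fun π _ => ?_
  have hzee : (zee π.parts : ℚ) ≠ 0 := Nat.cast_ne_zero.2 (zee_parts_ne_zero π)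
  rw [sum_congr rfl fun g hg => by rw [cycleProd, (mem_filter.1 hg).2], sum_const,
    ← Nat.cast_smul_eq_nsmul ℚ, ← nsmul_eq_mul, ← Nat.cast_smul_eq_nsmul ℚ, smul_smul,
    ← card_partition_eq_mul_zee π, Nat.cast_mul, mul_inv_cancel_right₀ hzee]

end ClassSize

section CycleTypes

theorem subtypeCongr_eq_mul {β : Type*} {p : β → Prop} [DecidablePred p]
    (e : Equiv.Perm {a // p a}) (f : Equiv.Perm {a // ¬ p a}) :
    e.subtypeCongr f = ofSubtype e * ofSubtype f := by
  ext x
  rw [mul_apply]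
  by_cases hx : p x
  · rw [subtypeCongr.left_apply _ _ hx, ofSubtype_apply_of_not_mem f (not_not.2 hx),
      ofSubtype_apply_of_mem e hx]
  · rw [subtypeCongr.right_apply _ _ hx, ofSubtype_apply_of_mem f hx,
      ofSubtype_apply_of_not_mem e (f ⟨x, hx⟩).2]

theorem subtypePerm_subtypeCongr {β : Type*} {p : β → Prop} [DecidablePred p] (h : Equiv.Perm β)
    (hp : ∀ x, p (h x) ↔ p x) :
    (h.subtypePerm hp).subtypeCongr (h.subtypePerm fun x => not_congr (hp x)) = h := by
  ext x
  by_cases hx : p x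
  · rw [subtypeCongr.left_apply _ _ hx, subtypePerm_apply]
  · rw [subtypeCongr.right_apply _ _ hx, subtypePerm_apply]

variable {α : Type*} [Fintype α] [DecidableEq α]

theorem cycleType_subtypeCongr {p : α → Prop} [DecidablePred p] (e : Equiv.Perm {a // p a})
    (f : Equiv.Perm {a // ¬ p a}) :
    (e.subtypeCongr f).cycleType = e.cycleType + f.cycleType := by
  have hdisj : (ofSubtype e).Disjoint (ofSubtype f) := by
    intro x
    by_cases hx : p x
    · exact Or.inr (ofSubtype_apply_of_not_mem f (not_not.2 hx))
    · exact Or.inl (ofSubtype_apply_of_not_mem e hx)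
  rw [subtypeCongr_eq_mul, hdisj.cycleType_mul, cycleType_ofSubtype, cycleType_ofSubtype]

theorem parts_subtypeCongr {p : α → Prop} [DecidablePred p] (e : Equiv.Perm {a // p a})
    (f : Equiv.Perm {a // ¬ p a}) :
    (e.subtypeCongr f).partition.parts = e.partition.parts + f.partition.parts := by
  have hcard : Fintype.card {a // p a} + Fintype.card {a // ¬ p a} = Fintype.card α := by
    rw [← Fintype.card_sum, Fintype.card_congr (Equiv.sumCompl p)]
  have he := e.sum_cycleType_le
  have hf := f.sum_cycleType_le
  simp only [parts_partition, ← sum_cycleType]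
  rw [cycleType_subtypeCongr, Multiset.sum_add,
    show Fintype.card α - (e.cycleType.sum + f.cycleType.sum) =
      (Fintype.card {a // p a} - e.cycleType.sum) +
        (Fintype.card {a // ¬ p a} - f.cycleType.sum) by omega,
    Multiset.replicate_add, add_add_add_comm]

theorem exists_pow_apply_eq_iff_dvd_of_mem_parts {g : Equiv.Perm α} {i : ℕ}
    (hi : i ∈ g.partition.parts) : ∃ y, ∀ j, (g ^ j) y = y ↔ i ∣ j := by
  rw [parts_partition, Multiset.mem_add] at hi
  rcases hi with hi | hi
  · rw [cycleType_def, Multiset.mem_map] at hi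
    obtain ⟨c, hc, rfl⟩ := hi
    have hcycle := (mem_cycleFactorsFinset_iff.1 hc).1
    obtain ⟨y, hy⟩ := nonempty_iff_ne_empty.2 (support_eq_empty_iff.not.2 hcycle.ne_one)
    refine ⟨y, fun j => ?_⟩
    rw [Function.comp_apply, ← hcycle.orderOf, orderOf_dvd_iff_pow_eq_one,
      hcycle.pow_eq_one_iff' (mem_support.1 hy), cycle_is_cycleOf hy hc, cycleOf_pow_apply_self]
  · obtain ⟨hne, rfl⟩ := Multiset.mem_replicate.1 hi
    obtain ⟨y, hy⟩ : ∃ y, y ∉ g.support := by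
      by_contra! hsupp
      rw [eq_univ_of_forall hsupp, card_univ, Nat.sub_self] at hne
      exact hne rfl
    exact ⟨y, fun j => iff_of_true (pow_apply_eq_self_of_apply_eq_self (notMem_support.1 hy) j)
      (one_dvd j)⟩

theorem parts_eq_replicate {g : Equiv.Perm α} {m r : ℕ} (hm : m ≠ 0) (hr : Fintype.card α = r * m)
    (hg : ∀ y j, (g ^ j) y = y ↔ m ∣ j) : g.partition.parts = Multiset.replicate r m := by
  have hparts : g.partition.parts = Multiset.replicate g.partition.parts.card m := by
    refine Multiset.eq_replicate_card.2 fun i hi => ?_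
    obtain ⟨y, hy⟩ := exists_pow_apply_eq_iff_dvd_of_mem_parts hi
    have hdvd (j : ℕ) : i ∣ j ↔ m ∣ j := (hy j).symm.trans (hg y j)
    exact Nat.dvd_antisymm ((hdvd m).2 dvd_rfl) ((hdvd i).1 dvd_rfl)
  have hsum := g.partition.parts_sum
  rw [hparts, Multiset.sum_replicate, smul_eq_mul] at hsum
  rw [hparts, Nat.eq_of_mul_eq_mul_right (Nat.pos_of_ne_zero hm) (hsum.trans hr)]

variable {R : Type*} [CommRing R]

theorem cycleProd_of_isEmpty [IsEmpty α] (P : ℕ → R) (g : Equiv.Perm α) : cycleProd P g = 1 := by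
  rw [Subsingleton.elim g 1, cycleProd, parts_partition]
  simp

theorem cycleProd_eq_pow {g : Equiv.Perm α} {m r : ℕ} (hm : m ≠ 0) (hr : Fintype.card α = r * m)
    (hg : ∀ y j, (g ^ j) y = y ↔ m ∣ j) (P : ℕ → R) : cycleProd P g = P m ^ r := by
  rw [cycleProd, parts_eq_replicate hm hr hg, Multiset.map_replicate, Multiset.prod_replicate]

theorem cycleProd_subtypeCongr {p : α → Prop} [DecidablePred p] (P : ℕ → R)
    (e : Equiv.Perm {a // p a}) (f : Equiv.Perm {a // ¬ p a}) :
    cycleProd P (e.subtypeCongr f) = cycleProd P e * cycleProd P f := by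
  rw [cycleProd, parts_subtypeCongr, Multiset.map_add, Multiset.prod_add, cycleProd, cycleProd]

/-- The weights `k ↦ P k` for `k` odd and `k ↦ P (k / 2) ^ 2` for `k` even: the square of a
`k`-cycle is a `k`-cycle when `k` is odd and a product of two `k / 2`-cycles when `k` is even. -/
def squareWeight (P : ℕ → R) (k : ℕ) : R := if Even k then P (k / 2) ^ 2 else P k

theorem cycleProd_mul_self_of_isCycleOn [Nonempty α] (P : ℕ → R) {h : Equiv.Perm α}
    (hh : h.IsCycleOn (univ : Finset α)) :
    cycleProd P (h * h) = cycleProd (squareWeight P) h := by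
  have hcard : Fintype.card α ≠ 0 := Fintype.card_ne_zero
  have hperiod (y : α) (j : ℕ) : (h ^ j) y = y ↔ Fintype.card α ∣ j :=
    hh.pow_apply_eq (mem_univ y)
  have hperiod_sq (y : α) (j : ℕ) : ((h * h) ^ j) y = y ↔ Fintype.card α ∣ 2 * j := by
    rw [← hperiod y, pow_mul, pow_two]
  rw [cycleProd_eq_pow hcard (one_mul _).symm hperiod, pow_one, squareWeight]
  rcases Nat.even_or_odd' (Fintype.card α) with ⟨m, hm | hm⟩
  · rw [if_pos ⟨m, hm.trans (two_mul m)⟩, hm, Nat.mul_div_cancel_left m two_pos]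
    refine cycleProd_eq_pow (by omega) hm (fun y j => ?_) P
    rw [hperiod_sq, hm]
    exact Nat.mul_dvd_mul_iff_left two_pos
  · have hodd : Odd (Fintype.card α) := ⟨m, hm⟩
    rw [if_neg (Nat.not_even_iff_odd.2 hodd)]
    refine (cycleProd_eq_pow hcard (one_mul _).symm (fun y j => ?_) P).trans (pow_one _)
    rw [hperiod_sq]
    exact (Nat.coprime_two_right.2 hodd).dvd_mul_left

theorem isCycleOn_subtypePerm_sameCycle {β : Type*} (h : Equiv.Perm β) (x : β) :
    (h.subtypePerm fun _ => sameCycle_apply_right :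
      Equiv.Perm {y // h.SameCycle x y}).IsCycleOn Set.univ := by
  refine ⟨Set.bijOn_univ.2 (Equiv.bijective _), fun y _ z _ => ?_⟩
  rw [sameCycle_subtypePerm]
  exact y.2.symm.trans z.2

theorem cycleProd_mul_self (P : ℕ → R) (h : Equiv.Perm α) :
    cycleProd P (h * h) = cycleProd (squareWeight P) h := by
  classical
  induction hk : Fintype.card α using Nat.strong_induction_on generalizing α with
  | _ k ih =>
    cases isEmpty_or_nonempty α with
    | inl _ => rw [cycleProd_of_isEmpty, cycleProd_of_isEmpty]
    | inr hne =>
      obtain ⟨x⟩ := hne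
      have hx : h.SameCycle x x := SameCycle.refl h x
      have hp (y : α) : h.SameCycle x (h y) ↔ h.SameCycle x y := sameCycle_apply_right
      have : Nonempty {y // h.SameCycle x y} := ⟨⟨x, hx⟩⟩
      have hlt : Fintype.card {y // ¬ h.SameCycle x y} < k :=
        hk ▸ Fintype.card_subtype_lt (x := x) (not_not.2 hx)
      have hcycle : (h.subtypePerm hp).IsCycleOn (univ : Finset {y // h.SameCycle x y}) := by
        rw [coe_univ]
        exact isCycleOn_subtypePerm_sameCycle h x
      rw [← subtypePerm_subtypeCongr (h * h) fun y => (hp (h y)).trans (hp y)]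
      conv_rhs => rw [← subtypePerm_subtypeCongr h hp]
      rw [cycleProd_subtypeCongr, cycleProd_subtypeCongr,
        ← cycleProd_mul_self_of_isCycleOn P hcycle, ← ih _ hlt _ rfl]
      rfl

variable {ι : Type*} [DecidableEq ι]

theorem card_perm_map_eq {f : α → ι} {s : Finset ι} (hf : ∀ i, f i ∈ s) :
    #{g : Equiv.Perm α | ∀ i, f (g i) = f i} = ∏ j ∈ s, (#{i | f i = j}).factorial := by
  rw [← Fintype.card_subtype, ← prod_subset (s₁ := univ.image f)]
  · simp only [← Fintype.card_subtype]
    rw [← DomMulAct.stabilizer_card' f]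
    exact Fintype.card_congr (Equiv.subtypeEquivRight fun g => funext_iff.symm)
  · exact image_subset_iff.2 fun i _ => hf i
  · intro j _ hj
    rw [filter_eq_empty_iff.2 fun i _ hi => hj (mem_image.2 ⟨i, mem_univ i, hi⟩), card_empty,
      Nat.factorial_zero]

theorem sum_cycleProd_map_eq_mul_sum (P : ℕ → R) (f : α → ι) (j : ι) :
    ∑ g : Equiv.Perm α with ∀ i, f (g i) = f i, cycleProd P g =
      (∑ e : Equiv.Perm {i // f i = j}, cycleProd P e) *
        ∑ g : Equiv.Perm {i // ¬ f i = j} with ∀ i, f (g i).1 = f i.1, cycleProd P g := by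
  rw [sum_mul_sum, ← sum_product']
  symm
  refine sum_bij (fun x _ => x.1.subtypeCongr x.2) ?_ ?_ ?_ ?_
  · rintro ⟨e, g⟩ hx
    simp only [mem_product, mem_univ, mem_filter, true_and] at hx ⊢
    intro i
    by_cases hi : f i = j
    · rw [subtypeCongr.left_apply e g hi]
      exact (e ⟨i, hi⟩).2.trans hi.symm
    · rw [subtypeCongr.right_apply e g hi]
      exact hx ⟨i, hi⟩
  · intro x _ y _ hxy
    exact subtypeCongrHom_injective (fun i => f i = j) hxy
  · intro g hg
    simp only [mem_filter, mem_univ, true_and] at hg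
    have hj (i : α) : f (g i) = j ↔ f i = j := by rw [hg i]
    refine ⟨(g.subtypePerm hj, g.subtypePerm fun i => not_congr (hj i)), ?_,
      subtypePerm_subtypeCongr g hj⟩
    simp only [mem_product, mem_univ, mem_filter, true_and]
    exact fun i => hg i
  · rintro ⟨e, g⟩ _
    rw [cycleProd_subtypeCongr]

theorem sum_cycleProd_map_eq [Algebra ℚ R] (P : ℕ → R) {f : α → ι} {s : Finset ι}
    (hf : ∀ i, f i ∈ s) :
    ∑ g : Equiv.Perm α with ∀ i, f (g i) = f i, cycleProd P g =
      #{g : Equiv.Perm α | ∀ i, f (g i) = f i} * ∏ j ∈ s, cycleExp P #{i | f i = j} := by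
  rw [card_perm_map_eq hf, Nat.cast_prod, ← prod_mul_distrib]
  induction s using Finset.induction_on generalizing α with
  | empty =>
    have : IsEmpty α := ⟨fun i => notMem_empty _ (hf i)⟩
    rw [prod_empty, filter_true_of_mem (fun g _ i => isEmptyElim i), Fintype.sum_unique,
      cycleProd_of_isEmpty]
  | insert j s hj ih =>
    have hrest (i : {i // ¬ f i = j}) : f i ∈ s := mem_of_mem_insert_of_ne (hf i) i.2
    have hcard : ∀ k ∈ s, #{i : {i // ¬ f i = j} | f i = k} = #{i | f i = k} := by
      intro k hk
      rw [← card_map (Function.Embedding.subtype _)]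
      congr 1
      ext i
      simp only [mem_map, mem_filter, mem_univ, true_and, Function.Embedding.coe_subtype,
        Subtype.exists, exists_and_left, exists_prop, exists_eq_right_right]
      exact and_iff_left_of_imp fun hi hij => hj (hij ▸ hi ▸ hk)
    rw [prod_insert hj, sum_cycleProd_map_eq_mul_sum P f j, ih hrest, sum_cycleProd,
      Fintype.card_subtype, prod_congr rfl fun k hk => by rw [hcard k hk]]

end CycleTypes

end SchurMult

namespace SchurMult

open Finset MvPolynomial

section Alternating

variable {N : ℕ} {R : Type*} [CommRing R]

/-- The coefficient of the monomial with exponent vector `v`, as a linear form. -/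
noncomputable def coeffAt (v : Fin N → ℕ) : MvPolynomial (Fin N) R →ₗ[R] R :=
  lcoeff R (Finsupp.equivFunOnFinite.symm v)

/-- The polynomials that change sign under every transposition of the variables. -/
def IsAlternating (G : MvPolynomial (Fin N) R) : Prop :=
  ∀ i j : Fin N, i ≠ j → rename (Equiv.swap i j) G = -G

theorem IsAlternating.mul {G F : MvPolynomial (Fin N) R} (hG : IsAlternating G)
    (hF : F.IsSymmetric) : IsAlternating (G * F) := fun i j hij => by
  rw [map_mul, hG i j hij, hF, neg_mul]

theorem coeffAt_comp_swap {G : MvPolynomial (Fin N) R} (hG : IsAlternating G) {i j : Fin N}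
    (hij : i ≠ j) (v : Fin N → ℕ) : coeffAt (v ∘ Equiv.swap i j) G = -coeffAt v G := by
  have hrename := coeff_rename_mapDomain (Equiv.swap i j) (Equiv.swap i j).injective G
    (Finsupp.equivFunOnFinite.symm v)
  rw [hG i j hij, coeff_neg] at hrename
  rw [coeffAt, coeffAt, lcoeff_apply, lcoeff_apply, ← hrename, neg_neg]
  congr 1
  ext k
  rw [Finsupp.mapDomain_equiv_apply]
  simp

section CharZero

variable [NoZeroDivisors R] [CharZero R]

theorem sum_coeffAt_eq_zero_of_comp_swap_mem {G : MvPolynomial (Fin N) R} (hG : IsAlternating G)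
    {i j : Fin N} (hij : i ≠ j) {B : Finset (Fin N → ℕ)}
    (hB : ∀ v ∈ B, v ∘ Equiv.swap i j ∈ B) : ∑ v ∈ B, coeffAt v G = 0 := by
  have hswap (v : Fin N → ℕ) : (v ∘ Equiv.swap i j) ∘ Equiv.swap i j = v := by
    ext k
    simp
  refine self_eq_neg.1 ?_
  rw [← sum_neg_distrib]
  refine sum_bij' (fun v _ => v ∘ Equiv.swap i j) (fun v _ => v ∘ Equiv.swap i j) hB hB
    (fun v _ => hswap v) (fun v _ => hswap v) fun v _ => ?_
  rw [coeffAt_comp_swap hG hij, neg_neg]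

theorem coeffAt_eq_zero_of_not_injective {G : MvPolynomial (Fin N) R} (hG : IsAlternating G)
    {v : Fin N → ℕ} (hv : ¬ Function.Injective v) : coeffAt v G = 0 := by
  simp only [Function.Injective, not_forall] at hv
  obtain ⟨i, j, hij, hne⟩ := hv
  have hfix : v ∘ Equiv.swap i j = v := by
    ext k
    rw [Function.comp_apply, Equiv.swap_apply_def]
    split_ifs with hki hkj
    · rw [hki, hij]
    · rw [hkj, hij]
    · rfl
  rw [← sum_singleton (fun v => coeffAt v G) v]
  refine sum_coeffAt_eq_zero_of_comp_swap_mem hG hne fun u hu => ?_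
  rw [mem_singleton.1 hu, hfix]
  exact mem_singleton_self v

end CharZero

/-- The exponent vector `l + δ`, where `δ = (N - 1, …, 1, 0)`. -/
def shift (l : Fin N → ℕ) (i : Fin N) : ℕ := l i + (N - 1 - i)

theorem shift_injective : Function.Injective (shift : (Fin N → ℕ) → Fin N → ℕ) :=
  fun _ _ h => funext fun i => Nat.add_right_cancel (congrFun h i)

theorem sum_shift (l : Fin N → ℕ) : ∑ i, shift l i = ∑ i, l i + ∑ i : Fin N, (N - 1 - (i : ℕ)) :=
  sum_add_distrib

theorem strictAnti_shift {l : Fin N → ℕ} (hl : Antitone l) : StrictAnti (shift l) := by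
  intro i j hij
  have hle := hl hij.le
  rw [Fin.lt_def] at hij
  simp only [shift]
  omega

theorem add_sub_le_of_strictAnti {v : Fin N → ℕ} (hv : StrictAnti v) {i j : Fin N} (hij : i ≤ j) :
    v j + (j - i) ≤ v i := by
  obtain ⟨k, hk⟩ := Nat.exists_eq_add_of_le (Fin.le_def.1 hij)
  induction k generalizing j with
  | zero => rw [Fin.ext (by omega : (j : ℕ) = i), Nat.sub_self, add_zero]
  | succ k ih =>
    have hlt : (i : ℕ) + k < N := by omega
    have hi := ih (j := ⟨i + k, hlt⟩) (by simp [Fin.le_def]) rfl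
    have hj : v j < v ⟨i + k, hlt⟩ := hv (by rw [Fin.lt_def]; simp only; omega)
    simp only at hi
    omega

theorem exists_shift_eq {v : Fin N → ℕ} (hv : StrictAnti v) :
    ∃ l : Fin N → ℕ, Antitone l ∧ shift l = v := by
  have hlow (i : Fin N) : N - 1 - (i : ℕ) ≤ v i := by
    have hi := i.2
    have hlast := add_sub_le_of_strictAnti hv (i := i) (j := ⟨N - 1, by omega⟩)
      (by rw [Fin.le_def]; simp only; omega)
    simp only at hlast
    omega
  refine ⟨fun i => v i - (N - 1 - i), fun i j hij => ?_,
    funext fun i => Nat.sub_add_cancel (hlow i)⟩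
  have hle := add_sub_le_of_strictAnti hv hij
  have hi := hlow i
  have hj := hlow j
  rw [Fin.le_def] at hij
  simp only
  omega

variable (N R) in
/-- The alternant `∑ sgn(w) x^(w δ)`, that is, the Vandermonde determinant. -/
noncomputable def alternant : MvPolynomial (Fin N) R :=
  ∑ w : Equiv.Perm (Fin N), ((Equiv.Perm.sign w : ℤ) : R) •
    monomial (Finsupp.equivFunOnFinite.symm fun i => N - 1 - (w i : ℕ)) 1

theorem isAlternating_alternant : IsAlternating (alternant N R) := by
  intro i j hij
  rw [alternant, map_sum, ← sum_neg_distrib]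
  refine sum_equiv (Equiv.mulRight (Equiv.swap i j)) (by simp) fun w _ => ?_
  rw [map_smul, rename_monomial, Equiv.coe_mulRight, Equiv.Perm.sign_mul,
    Equiv.Perm.sign_swap hij, mul_neg, mul_one, Units.val_neg, Int.cast_neg, neg_smul, neg_neg]
  congr 3
  ext k
  rw [Finsupp.mapDomain_equiv_apply]
  simp

theorem eq_zero_and_eq_one_of_shift_eq {l : Fin N → ℕ} {w : Equiv.Perm (Fin N)}
    (hw : (fun i => N - 1 - (w i : ℕ)) = shift l) : l = 0 ∧ w = 1 := by
  have hsum : ∑ i, (N - 1 - (w i : ℕ)) = ∑ i, shift l i := by rw [← hw]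
  rw [sum_shift, Equiv.sum_comp w fun i : Fin N => N - 1 - (i : ℕ)] at hsum
  have hl : l = 0 := funext fun i => sum_eq_zero_iff.1 (by omega : ∑ i, l i = 0) i (mem_univ i)
  refine ⟨hl, Equiv.ext fun i => Fin.ext ?_⟩
  have hi := congrFun hw i
  have hwi := (w i).2
  have hi₂ := i.2
  simp only [shift, hl, Pi.zero_apply] at hi
  rw [Equiv.Perm.coe_one, id_eq]
  omega

/-- The coefficient of `x ^ (l + δ)` in the product of `F` with the alternant. When `F` is a
symmetric polynomial and `l` is a partition, this is the coefficient of the Schur polynomial `s_l`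
in the expansion of `F`. -/
noncomputable def schurCoeff (l : Fin N → ℕ) : MvPolynomial (Fin N) R →ₗ[R] R :=
  coeffAt (shift l) ∘ₗ LinearMap.mulLeft R (alternant N R)

theorem schurCoeff_apply (l : Fin N → ℕ) (F : MvPolynomial (Fin N) R) :
    schurCoeff l F = coeffAt (shift l) (alternant N R * F) := rfl

theorem schurCoeff_one (l : Fin N → ℕ) :
    schurCoeff l (1 : MvPolynomial (Fin N) R) = if l = 0 then 1 else 0 := by
  rw [schurCoeff_apply, mul_one, coeffAt, lcoeff_apply, alternant, coeff_sum]
  simp only [coeff_smul, coeff_monomial, smul_eq_mul, mul_ite, mul_one, mul_zero,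
    Equiv.apply_eq_iff_eq]
  split_ifs with hl
  · rw [sum_eq_single_of_mem 1 (mem_univ 1) fun w _ hw =>
      if_neg fun h => hw (eq_zero_and_eq_one_of_shift_eq h).2, if_pos, Equiv.Perm.sign_one,
      Units.val_one, Int.cast_one]
    ext i
    simp [shift, hl]
  · exact sum_eq_zero fun w _ => if_neg fun h => hl (eq_zero_and_eq_one_of_shift_eq h).1

end Alternating

section VerticalPieri

variable {N : ℕ} {R : Type*} [CommRing R]

theorem coeffAt_mul_prod_X (G : MvPolynomial (Fin N) R) (S : Finset (Fin N)) (v : Fin N → ℕ) :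
    coeffAt v (G * ∏ i ∈ S, X i) =
      if ∀ i ∈ S, 1 ≤ v i then coeffAt (fun i => v i - if i ∈ S then 1 else 0) G else 0 := by
  have hprod : (∏ i ∈ S, X i : MvPolynomial (Fin N) R) =
      monomial (Finsupp.equivFunOnFinite.symm fun i => if i ∈ S then 1 else 0) 1 := by
    rw [monomial_eq, map_one, one_mul, Finsupp.prod_fintype _ _ fun i => pow_zero _]
    simp [prod_ite_mem]
  have hle : (Finsupp.equivFunOnFinite.symm fun i => if i ∈ S then 1 else 0) ≤
      Finsupp.equivFunOnFinite.symm v ↔ ∀ i ∈ S, 1 ≤ v i := by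
    rw [Finsupp.le_def]
    refine forall_congr' fun i => ?_
    by_cases hi : i ∈ S <;> simp [hi]
  rw [hprod, coeffAt, lcoeff_apply, coeff_mul_monomial', mul_one]
  refine if_congr hle ?_ rfl
  rw [coeffAt, lcoeff_apply]
  congr 1
  ext i
  simp

theorem exists_shift_eq_shift_sub {l : Fin N → ℕ} (hl : Antitone l) {S : Finset (Fin N)}
    (hinj : Function.Injective fun i => shift l i - if i ∈ S then 1 else 0)
    (hS : ∀ i ∈ S, 1 ≤ shift l i) :
    ∃ μ : Fin N → ℕ, Antitone μ ∧ (∀ i, l i = μ i + if i ∈ S then 1 else 0) ∧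
      shift μ = fun i => shift l i - if i ∈ S then 1 else 0 := by
  have hanti : StrictAnti fun i => shift l i - if i ∈ S then 1 else 0 := by
    intro i j hij
    refine lt_of_le_of_ne ?_ fun h => hij.ne' (hinj h)
    have hlt := strictAnti_shift hl hij
    beta_reduce
    split_ifs <;> omega
  obtain ⟨μ, hμ, hshift⟩ := exists_shift_eq hanti
  refine ⟨μ, hμ, fun i => ?_, hshift⟩
  have hi := congrFun hshift i
  have hpos := hS i
  simp only [shift] at hi hpos
  split_ifs at hi ⊢ with hiS
  · have := hpos hiS
    omega
  · omega

theorem schurCoeff_mul_prod_X_of_eq {F : MvPolynomial (Fin N) R} {l μ : Fin N → ℕ}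
    {S : Finset (Fin N)} (h : ∀ i, l i = μ i + if i ∈ S then 1 else 0) :
    schurCoeff l (F * ∏ i ∈ S, X i) = schurCoeff μ F := by
  rw [schurCoeff_apply, ← mul_assoc, coeffAt_mul_prod_X,
    if_pos fun i hi => by rw [shift, h i, if_pos hi]; omega, schurCoeff_apply]
  congr 2
  ext i
  rw [shift, shift, h i]
  omega

theorem schurCoeff_mul_esymm (F : MvPolynomial (Fin N) R) (l : Fin N → ℕ) (r : ℕ) :
    schurCoeff l (F * esymm (Fin N) R r) =
      ∑ S ∈ powersetCard r univ, schurCoeff l (F * ∏ i ∈ S, X i) := by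
  rw [esymm, mul_sum, map_sum]

variable [NoZeroDivisors R] [CharZero R]

theorem exists_antitone_of_schurCoeff_mul_prod_X_ne_zero {F : MvPolynomial (Fin N) R}
    (hF : F.IsSymmetric) {l : Fin N → ℕ} (hl : Antitone l) {S : Finset (Fin N)}
    (hne : schurCoeff l (F * ∏ i ∈ S, X i) ≠ 0) :
    ∃ μ : Fin N → ℕ, Antitone μ ∧ ∀ i, l i = μ i + if i ∈ S then 1 else 0 := by
  rw [schurCoeff_apply, ← mul_assoc, coeffAt_mul_prod_X] at hne
  obtain ⟨hS, hcoeff⟩ := ite_ne_right_iff.1 hne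
  obtain ⟨μ, hμ, hlμ, -⟩ := exists_shift_eq_shift_sub hl
    (not_not.1 fun hinj =>
      hcoeff (coeffAt_eq_zero_of_not_injective (isAlternating_alternant.mul hF) hinj)) hS
  exact ⟨μ, hμ, hlμ⟩

end VerticalPieri

section HorizontalPieri

variable {N : ℕ} {R : Type*} [CommRing R]

theorem hsymm_eq_sum_monomial {σ : Type*} [Fintype σ] [DecidableEq σ] (r : ℕ) :
    hsymm σ R r = ∑ d ∈ finsuppAntidiag univ r, monomial d 1 := by
  refine sum_bij' (fun s _ => Multiset.toFinsupp s.1)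
    (fun d hd => ⟨Finsupp.toMultiset d, ?_⟩) ?_ ?_ ?_ ?_ ?_
  · rw [Finsupp.card_toMultiset, Finsupp.sum_fintype _ _ fun _ => rfl]
    exact (mem_finsuppAntidiag.1 hd).1
  · intro s _
    rw [mem_finsuppAntidiag]
    exact ⟨(Multiset.sum_count_eq_card fun a _ => mem_univ a).trans s.2, subset_univ _⟩
  · exact fun _ _ => mem_univ _
  · exact fun s _ => Subtype.ext (by simp)
  · exact fun d _ => by simp
  · intro s _
    rw [monomial_eq, map_one, one_mul, Finsupp.prod, Multiset.toFinsupp_support,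
      prod_multiset_map_count]
    simp only [Multiset.toFinsupp_apply]

theorem coeffAt_mul_hsymm (G : MvPolynomial (Fin N) R) (r : ℕ) (v : Fin N → ℕ) :
    coeffAt v (G * hsymm (Fin N) R r) =
      ∑ β ∈ Fintype.piFinset (fun i => range (v i + 1)) with ∑ i, β i + r = ∑ i, v i,
        coeffAt β G := by
  rw [coeffAt, hsymm_eq_sum_monomial, mul_sum, map_sum]
  simp only [lcoeff_apply, coeff_mul_monomial', mul_one]
  rw [← sum_filter]
  refine sum_bij' (fun d _ => fun i => v i - d i)
    (fun β _ => Finsupp.equivFunOnFinite.symm fun i => v i - β i) ?_ ?_ ?_ ?_ ?_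
  · intro d hd
    simp only [mem_filter, mem_finsuppAntidiag, Finsupp.le_def,
      Finsupp.equivFunOnFinite_symm_apply_apply] at hd
    obtain ⟨⟨hsum, -⟩, hle⟩ := hd
    simp only [mem_filter, Fintype.mem_piFinset, mem_range]
    refine ⟨fun i => by omega, ?_⟩
    rw [← hsum, ← sum_add_distrib]
    exact sum_congr rfl fun i _ => Nat.sub_add_cancel (hle i)
  · intro β hβ
    simp only [mem_filter, Fintype.mem_piFinset, mem_range] at hβ
    simp only [mem_filter, mem_finsuppAntidiag, Finsupp.le_def,
      Finsupp.equivFunOnFinite_symm_apply_apply]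
    refine ⟨⟨?_, subset_univ _⟩, fun i => Nat.sub_le _ _⟩
    have hsum : ∑ i, (v i - β i) + ∑ i, β i = ∑ i, v i := by
      rw [← sum_add_distrib]
      exact sum_congr rfl fun i _ => Nat.sub_add_cancel (Nat.lt_succ_iff.1 (hβ.1 i))
    omega
  · intro d hd
    simp only [mem_filter, Finsupp.le_def, Finsupp.equivFunOnFinite_symm_apply_apply] at hd
    ext i
    exact Nat.sub_sub_self (hd.2 i)
  · intro β hβ
    simp only [mem_filter, Fintype.mem_piFinset, mem_range] at hβ
    ext i
    exact Nat.sub_sub_self (Nat.lt_succ_iff.1 (hβ.1 i))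
  · intro d _
    rw [coeffAt, lcoeff_apply]
    congr 1
    ext i
    simp

/-- The exponent vectors `β ≤ v` of total degree `r` less than `v` that interlace with `v` in the
first `k` places. -/
def interlacing (v : Fin N → ℕ) (r k : ℕ) : Finset (Fin N → ℕ) :=
  {β ∈ Fintype.piFinset (fun i => range (v i + 1)) |
    ∑ i, β i + r = ∑ i, v i ∧ ∀ i j : Fin N, (i : ℕ) < k → i < j → v j < β i}

theorem mem_interlacing {v β : Fin N → ℕ} {r k : ℕ} : β ∈ interlacing v r k ↔
    (∀ i, β i ≤ v i) ∧ ∑ i, β i + r = ∑ i, v i ∧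
      ∀ i j : Fin N, (i : ℕ) < k → i < j → v j < β i := by
  simp only [interlacing, mem_filter, Fintype.mem_piFinset, mem_range, Nat.lt_succ_iff]

/-- The partitions `μ` such that `l / μ` is a horizontal strip of size `r`. -/
def horizontalStrips (l : Fin N → ℕ) (r : ℕ) : Finset (Fin N → ℕ) :=
  {μ ∈ Fintype.piFinset (fun i => range (l i + 1)) |
    (∀ i j, i < j → l j ≤ μ i) ∧ ∑ i, μ i + r = ∑ i, l i}

theorem mem_horizontalStrips {l μ : Fin N → ℕ} {r : ℕ} : μ ∈ horizontalStrips l r ↔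
    (∀ i, μ i ≤ l i) ∧ (∀ i j, i < j → l j ≤ μ i) ∧ ∑ i, μ i + r = ∑ i, l i := by
  simp only [horizontalStrips, mem_filter, Fintype.mem_piFinset, mem_range, Nat.lt_succ_iff]

theorem antitone_of_mem_horizontalStrips {l μ : Fin N → ℕ} {r : ℕ}
    (h : μ ∈ horizontalStrips l r) : Antitone μ := by
  obtain ⟨hle, hinterlace, -⟩ := mem_horizontalStrips.1 h
  intro i j hij
  rcases hij.eq_or_lt with rfl | hlt
  · exact le_rfl
  · exact (hle j).trans (hinterlace i j hlt)

theorem shift_mem_interlacing {l μ : Fin N → ℕ} (hl : Antitone l) {r : ℕ} :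
    shift μ ∈ interlacing (shift l) r N ↔ μ ∈ horizontalStrips l r := by
  rw [mem_interlacing, mem_horizontalStrips, sum_shift, sum_shift]
  refine and_congr (forall_congr' fun i => Nat.add_le_add_iff_right) ?_
  rw [and_comm]
  refine and_congr ⟨fun h i j hij => ?_, fun h i j _ hij => ?_⟩ (by omega)
  · rw [Fin.lt_def] at hij
    have hnext := h i ⟨i + 1, by omega⟩ i.2 (Nat.lt_succ_self _)
    have hle := hl (show (⟨i + 1, by omega⟩ : Fin N) ≤ j from hij)
    simp only [shift] at hnext
    omega
  · have hle := h i j hij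
    rw [Fin.lt_def] at hij
    simp only [shift]
    omega

theorem interlacing_succ_subset (v : Fin N → ℕ) (r k : ℕ) :
    interlacing v r (k + 1) ⊆ interlacing v r k := fun β hβ => by
  rw [mem_interlacing] at hβ ⊢
  exact ⟨hβ.1, hβ.2.1, fun i j hi => hβ.2.2 i j (hi.trans k.lt_succ_self)⟩

theorem interlacing_succ_eq_self (v : Fin N → ℕ) (r : ℕ) {k : ℕ} (hk : N ≤ k + 1) :
    interlacing v r (k + 1) = interlacing v r k := by
  refine (interlacing_succ_subset v r k).antisymm fun β hβ => ?_
  rw [mem_interlacing] at hβ ⊢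
  refine ⟨hβ.1, hβ.2.1, fun i j _ hij => hβ.2.2 i j ?_ hij⟩
  rw [Fin.lt_def] at hij
  omega

theorem not_mem_interlacing_succ {v β : Fin N → ℕ} (hv : Antitone v) {r k : ℕ} (hk : k + 1 < N)
    (hβ : β ∈ interlacing v r k) :
    β ∉ interlacing v r (k + 1) ↔ β ⟨k, k.lt_succ_self.trans hk⟩ ≤ v ⟨k + 1, hk⟩ := by
  rw [mem_interlacing] at hβ
  rw [mem_interlacing, ← not_lt, not_iff_not]
  refine ⟨fun h => h.2.2 _ _ k.lt_succ_self k.lt_succ_self, fun h => ⟨hβ.1, hβ.2.1, ?_⟩⟩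
  intro i j hi hij
  rcases (Nat.lt_succ_iff.1 hi).eq_or_lt with rfl | hlt
  · exact (hv (show (⟨i + 1, hk⟩ : Fin N) ≤ j from hij)).trans_lt h
  · exact hβ.2.2 i j hlt hij

theorem comp_swap_mem_interlacing {v β : Fin N → ℕ} (hv : Antitone v) {r k : ℕ} (hk : k + 1 < N)
    (hβ : β ∈ interlacing v r k) (hle : β ⟨k, k.lt_succ_self.trans hk⟩ ≤ v ⟨k + 1, hk⟩) :
    β ∘ Equiv.swap ⟨k, k.lt_succ_self.trans hk⟩ ⟨k + 1, hk⟩ ∈ interlacing v r k := by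
  rw [mem_interlacing] at hβ ⊢
  obtain ⟨hbound, hsum, hinterlace⟩ := hβ
  refine ⟨fun i => ?_, (congrArg (· + r) (Equiv.sum_comp (Equiv.swap _ _) β)).trans hsum,
    fun i j hi hij => ?_⟩
  · rw [Function.comp_apply, Equiv.swap_apply_def]
    split_ifs with hik hik'
    · exact (hbound _).trans (hv (by simp [hik, Fin.le_def]))
    · exact hik' ▸ hle
    · exact hbound i
  · rw [Function.comp_apply, Equiv.swap_apply_of_ne_of_ne]
    · exact hinterlace i j hi hij
    · exact fun h => hi.ne (congrArg Fin.val h)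
    · exact fun h => (hi.trans k.lt_succ_self).ne (congrArg Fin.val h)

variable [NoZeroDivisors R] [CharZero R]

theorem sum_coeffAt_interlacing_succ {G : MvPolynomial (Fin N) R} (hG : IsAlternating G)
    {v : Fin N → ℕ} (hv : Antitone v) (r k : ℕ) :
    ∑ β ∈ interlacing v r (k + 1), coeffAt β G = ∑ β ∈ interlacing v r k, coeffAt β G := by
  rcases le_or_gt N (k + 1) with hk | hk
  · rw [interlacing_succ_eq_self v r hk]
  rw [← sum_sdiff (interlacing_succ_subset v r k), right_eq_add]
  have hne : (⟨k, k.lt_succ_self.trans hk⟩ : Fin N) ≠ ⟨k + 1, hk⟩ :=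
    fun h => k.lt_succ_self.ne (congrArg Fin.val h)
  refine sum_coeffAt_eq_zero_of_comp_swap_mem hG hne fun β hβ => ?_
  rw [mem_sdiff] at hβ ⊢
  have hle := (not_mem_interlacing_succ hv hk hβ.1).1 hβ.2
  have hswap := comp_swap_mem_interlacing hv hk hβ.1 hle
  refine ⟨hswap, (not_mem_interlacing_succ hv hk hswap).2 ?_⟩
  rw [Function.comp_apply, Equiv.swap_apply_left]
  exact (mem_interlacing.1 hβ.1).1 _

theorem sum_coeffAt_interlacing {G : MvPolynomial (Fin N) R} (hG : IsAlternating G)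
    {v : Fin N → ℕ} (hv : Antitone v) (r k : ℕ) :
    ∑ β ∈ interlacing v r k, coeffAt β G = coeffAt v (G * hsymm (Fin N) R r) := by
  induction k with
  | zero =>
    rw [coeffAt_mul_hsymm]
    simp only [interlacing, Nat.not_lt_zero, false_imp_iff, implies_true, and_true]
  | succ k ih => rw [sum_coeffAt_interlacing_succ hG hv, ih]

theorem strictAnti_of_mem_interlacing {v β : Fin N → ℕ} {r : ℕ} (hβ : β ∈ interlacing v r N) :
    StrictAnti β := fun i j hij =>
  ((mem_interlacing.1 hβ).1 j).trans_lt ((mem_interlacing.1 hβ).2.2 i j i.2 hij)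

theorem schurCoeff_mul_hsymm {F : MvPolynomial (Fin N) R} (hF : F.IsSymmetric) {l : Fin N → ℕ}
    (hl : Antitone l) (r : ℕ) :
    schurCoeff l (F * hsymm (Fin N) R r) = ∑ μ ∈ horizontalStrips l r, schurCoeff μ F := by
  rw [schurCoeff_apply, ← mul_assoc, ← sum_coeffAt_interlacing (isAlternating_alternant.mul hF)
    (strictAnti_shift hl).antitone r N]
  symm
  refine sum_bij (fun μ _ => shift μ) (fun μ hμ => (shift_mem_interlacing hl).2 hμ)
    (fun μ _ ν _ h => shift_injective h) (fun β hβ => ?_) fun μ _ => rfl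
  obtain ⟨μ, -, rfl⟩ := exists_shift_eq (strictAnti_of_mem_interlacing hβ)
  exact ⟨μ, (shift_mem_interlacing hl).1 hβ, rfl⟩

end HorizontalPieri

section SymmetricPolynomials

variable {σ R : Type*} [Fintype σ] [CommRing R] [Algebra ℚ R]

theorem cycleExp_psum [DecidableEq σ] (r : ℕ) : cycleExp (psum σ R) r = hsymm σ R r := by
  have hpsum : psum σ R = ∑ v : σ, fun k => (X v : MvPolynomial σ R) ^ k := by
    ext1 k
    rw [psum, Finset.sum_apply]
  rw [← coeff_expSeries, hpsum, expSeries_sum, PowerSeries.coeff_prod, hsymm_eq_sum_monomial]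
  refine sum_congr rfl fun d _ => ?_
  rw [monomial_eq, map_one, one_mul, Finsupp.prod_fintype _ _ fun _ => pow_zero _]
  exact prod_congr rfl fun v _ => by rw [expSeries_pow, PowerSeries.coeff_mk]

theorem expSeries_neg_psum (s : R) :
    expSeries (fun k => -(-s) ^ k • psum σ R k) =
      ∏ v : σ, (1 + PowerSeries.C (s • (X v : MvPolynomial σ R)) * PowerSeries.X) := by
  have hpsum : (fun k => -(-s) ^ k • psum σ R k) =
      ∑ v : σ, fun k => -(-(s • (X v : MvPolynomial σ R))) ^ k := by
    ext1 k
    rw [psum, Finset.sum_apply, smul_sum]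
    exact sum_congr rfl fun v _ => by rw [← neg_smul, smul_pow, neg_smul]
  rw [hpsum, expSeries_sum]
  exact prod_congr rfl fun v _ => expSeries_neg_pow _

theorem cycleExp_neg_psum (s : R) (r : ℕ) :
    cycleExp (fun k => -(-s) ^ k • psum σ R k) r = s ^ r • esymm σ R r := by
  have hcoeff (S : Finset σ) : PowerSeries.coeff r
      (∏ v ∈ S, PowerSeries.C (s • (X v : MvPolynomial σ R)) * PowerSeries.X) =
      if #S = r then s ^ r • ∏ v ∈ S, X v else 0 := by
    rw [prod_mul_distrib, prod_const, ← map_prod, PowerSeries.coeff_C_mul, PowerSeries.coeff_X_pow]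
    by_cases hS : #S = r
    · rw [if_pos hS.symm, if_pos hS, mul_one, ← hS, ← prod_const, prod_smul]
    · rw [if_neg (Ne.symm hS), if_neg hS, mul_zero]
  rw [← coeff_expSeries, expSeries_neg_psum, prod_one_add, map_sum, esymm, smul_sum,
    powersetCard_eq_filter, sum_filter]
  exact sum_congr rfl fun S _ => hcoeff S

omit [Fintype σ] in
theorem cycleExp_isSymmetric {P : ℕ → MvPolynomial σ R} (hP : ∀ k, (P k).IsSymmetric) (m : ℕ) :
    (cycleExp P m).IsSymmetric := by
  intro e
  rw [cycleExp, map_sum]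
  refine sum_congr rfl fun π _ => ?_
  rw [map_rat_smul, map_multiset_prod, Multiset.map_map]
  congr 2
  exact Multiset.map_congr rfl fun k _ => hP k e

end SymmetricPolynomials

section CompleteTriangularity

variable {N : ℕ} {R : Type*} [CommRing R]

theorem isSymmetric_prod {σ ι : Type*} {s : Finset ι} {F : ι → MvPolynomial σ R}
    (hF : ∀ i ∈ s, (F i).IsSymmetric) : (∏ i ∈ s, F i).IsSymmetric :=
  (symmetricSubalgebra σ R).prod_mem hF

theorem sum_min_le_of_mem_horizontalStrips {l μ : Fin N → ℕ} {r : ℕ}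
    (h : μ ∈ horizontalStrips l r) (m : ℕ) :
    ∑ i, min (l i) m ≤ ∑ i, min (μ i) m + min r m := by
  obtain ⟨hle, hinterlace, hsum⟩ := mem_horizontalStrips.1 h
  have hr : ∑ i, min (l i) m + ∑ i, μ i ≤ ∑ i, min (μ i) m + ∑ i, l i := by
    rw [← sum_add_distrib, ← sum_add_distrib]
    refine sum_le_sum fun i _ => ?_
    have := hle i
    omega
  have hm : ∑ i, min (l i) m ≤ ∑ i, min (μ i) m + m := by
    cases N with
    | zero => simp
    | succ N =>
      rw [Fin.sum_univ_succ, Fin.sum_univ_castSucc fun i => min (μ i) m]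
      have htail : ∑ i : Fin N, min (l i.succ) m ≤ ∑ i : Fin N, min (μ i.castSucc) m :=
        sum_le_sum fun i _ => min_le_min_right m (hinterlace _ _ Fin.castSucc_lt_succ)
      have hhead := min_le_right (l 0) m
      omega
  omega

theorem eq_zero_of_mem_horizontalStrips {l μ : Fin N → ℕ} {r k : ℕ}
    (h : μ ∈ horizontalStrips l r) (hμ : ∀ i : Fin N, k ≤ i → μ i = 0) (i : Fin N)
    (hi : k + 1 ≤ i) : l i = 0 := by
  have hle := (mem_horizontalStrips.1 h).2.1 ⟨i - 1, by omega⟩ i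
    (by rw [Fin.lt_def]; simp only; omega)
  rw [hμ ⟨i - 1, by omega⟩ (by simp only; omega)] at hle
  omega

variable (N) in
/-- The first `k` terms of the sequence `ν`, padded with zeros to a vector of length `N`. -/
def truncate (ν : ℕ → ℕ) (k : ℕ) (i : Fin N) : ℕ := if (i : ℕ) < k then ν i else 0

theorem truncate_zero (ν : ℕ → ℕ) : truncate N ν 0 = 0 :=
  funext fun i => if_neg i.1.not_lt_zero

theorem truncate_succ (ν : ℕ → ℕ) {k : ℕ} (hk : k < N) :
    truncate N ν (k + 1) = truncate N ν k + Pi.single ⟨k, hk⟩ (ν k) := by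
  ext i
  rcases lt_trichotomy (i : ℕ) k with h | h | h
  · simp [truncate, h, h.trans k.lt_succ_self, Fin.ext_iff, h.ne]
  · simp [truncate, ← h]
  · simp [truncate, h.not_gt, Nat.not_lt.2 (Nat.succ_le_of_lt h), Fin.ext_iff, h.ne']

theorem antitone_truncate {ν : ℕ → ℕ} (hν : Antitone ν) (k : ℕ) : Antitone (truncate N ν k) := by
  intro i j hij
  have hle := hν (Fin.le_def.1 hij)
  rw [Fin.le_def] at hij
  simp only [truncate]
  split_ifs <;> omega

theorem sum_truncate_succ (ν : ℕ → ℕ) {k : ℕ} (hk : k < N) :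
    ∑ i, truncate N ν (k + 1) i = ∑ i, truncate N ν k i + ν k := by
  simp only [truncate_succ ν hk, Pi.add_apply, sum_add_distrib, sum_pi_single', mem_univ, if_true]

theorem truncate_mem_horizontalStrips {ν : ℕ → ℕ} (hν : Antitone ν) {k : ℕ} (hk : k < N) :
    truncate N ν k ∈ horizontalStrips (truncate N ν (k + 1)) (ν k) := by
  refine mem_horizontalStrips.2
    ⟨fun i => ?_, fun i j hij => ?_, (sum_truncate_succ ν hk).symm⟩
  · simp only [truncate]
    split_ifs <;> omega
  · have hle := hν (Fin.lt_def.1 hij).le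
    rw [Fin.lt_def] at hij
    simp only [truncate]
    split_ifs <;> omega

theorem eq_truncate_of_mem_horizontalStrips {ν : ℕ → ℕ} {k : ℕ} (hk : k < N) {μ : Fin N → ℕ}
    (hμ : μ ∈ horizontalStrips (truncate N ν (k + 1)) (ν k))
    (hzero : ∀ i : Fin N, k ≤ i → μ i = 0) : μ = truncate N ν k := by
  obtain ⟨hle, -, hsum⟩ := mem_horizontalStrips.1 hμ
  rw [sum_truncate_succ ν hk] at hsum
  have hle' (i : Fin N) (_ : i ∈ univ) : μ i ≤ truncate N ν k i := by
    have hi := hle i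
    have hi₀ := hzero i
    simp only [truncate] at hi ⊢
    split_ifs at hi ⊢ <;> omega
  exact funext fun i => (sum_eq_sum_iff_of_le hle').1 (by omega) i (mem_univ i)

variable [NoZeroDivisors R] [CharZero R]

theorem sum_min_le_of_schurCoeff_prod_hsymm_ne_zero (ν : ℕ → ℕ) (k : ℕ) {l : Fin N → ℕ}
    (hl : Antitone l) (hne : schurCoeff l (∏ j ∈ range k, hsymm (Fin N) R (ν j)) ≠ 0) :
    (∀ m, ∑ i, min (l i) m ≤ ∑ j ∈ range k, min (ν j) m) ∧ ∀ i : Fin N, k ≤ i → l i = 0 := by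
  induction k generalizing l with
  | zero =>
    rw [prod_range_zero, schurCoeff_one, ne_eq, ite_eq_right_iff, Classical.not_imp] at hne
    simp [hne.1]
  | succ k ih =>
    rw [prod_range_succ, schurCoeff_mul_hsymm
      (isSymmetric_prod fun _ _ => hsymm_isSymmetric _ _ _) hl] at hne
    obtain ⟨μ, hμ, hμne⟩ := exists_ne_zero_of_sum_ne_zero hne
    obtain ⟨hmin, hzero⟩ := ih (antitone_of_mem_horizontalStrips hμ) hμne
    refine ⟨fun m => ?_, eq_zero_of_mem_horizontalStrips hμ hzero⟩
    rw [sum_range_succ]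
    exact (sum_min_le_of_mem_horizontalStrips hμ m).trans (Nat.add_le_add_right (hmin m) _)

theorem schurCoeff_truncate_prod_hsymm {ν : ℕ → ℕ} (hν : Antitone ν) {k : ℕ} (hk : k ≤ N) :
    schurCoeff (truncate N ν k) (∏ j ∈ range k, hsymm (Fin N) R (ν j)) = 1 := by
  induction k with
  | zero => rw [prod_range_zero, schurCoeff_one, if_pos (truncate_zero ν)]
  | succ k ih =>
    rw [prod_range_succ, schurCoeff_mul_hsymm (isSymmetric_prod fun _ _ => hsymm_isSymmetric _ _ _)
      (antitone_truncate hν _), sum_eq_single_of_mem _ (truncate_mem_horizontalStrips hν hk),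
      ih (Nat.le_of_succ_le hk)]
    intro μ hμ hne
    by_contra hcoeff
    exact hne (eq_truncate_of_mem_horizontalStrips hk hμ
      (sum_min_le_of_schurCoeff_prod_hsymm_ne_zero ν k (antitone_of_mem_horizontalStrips hμ)
        hcoeff).2)

end CompleteTriangularity

section ElementaryTriangularity

variable {N : ℕ} {R : Type*} [CommRing R] [NoZeroDivisors R] [CharZero R]

theorem sum_le_sum_min_of_schurCoeff_prod_esymm_ne_zero (κ : ℕ → ℕ) (k : ℕ) {l : Fin N → ℕ}
    (hl : Antitone l) (hne : schurCoeff l (∏ j ∈ range k, esymm (Fin N) R (κ j)) ≠ 0) :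
    (∀ i, l i ≤ k) ∧ ∑ i, l i = ∑ j ∈ range k, κ j ∧
      ∀ m ≤ k, ∑ j ∈ range m, κ j ≤ ∑ i, min (l i) m := by
  induction k generalizing l with
  | zero =>
    rw [prod_range_zero, schurCoeff_one, ne_eq, ite_eq_right_iff, Classical.not_imp] at hne
    simp [hne.1]
  | succ k ih =>
    rw [prod_range_succ, schurCoeff_mul_esymm] at hne
    obtain ⟨S, hS, hSne⟩ := exists_ne_zero_of_sum_ne_zero hne
    obtain ⟨μ, hμ, hlμ⟩ := exists_antitone_of_schurCoeff_mul_prod_X_ne_zero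
      (isSymmetric_prod fun _ _ => esymm_isSymmetric _ _ _) hl hSne
    rw [schurCoeff_mul_prod_X_of_eq hlμ] at hSne
    obtain ⟨hbound, hsum, hmin⟩ := ih hμ hSne
    have hle (i : Fin N) : l i ≤ k + 1 := by
      have := hbound i
      rw [hlμ i]
      split_ifs <;> omega
    have hsum_succ : ∑ i, l i = ∑ j ∈ range (k + 1), κ j := by
      rw [sum_congr rfl fun i _ => hlμ i, sum_add_distrib, hsum, sum_range_succ,
        ← (mem_powersetCard.1 hS).2, sum_boole]
      simp only [filter_univ_mem, Nat.cast_id]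
    refine ⟨hle, hsum_succ, fun m hm => ?_⟩
    rcases hm.lt_or_eq with hlt | rfl
    · refine (hmin m (by omega)).trans (sum_le_sum fun i _ => min_le_min_right m ?_)
      rw [hlμ i]
      omega
    · rw [← hsum_succ]
      exact (sum_congr rfl fun i _ => (min_eq_left (hle i)).symm).le

theorem schurCoeff_min_prod_esymm {l : Fin N → ℕ} (hl : Antitone l) (k : ℕ) :
    schurCoeff (fun i => min (l i) k) (∏ j ∈ range k, esymm (Fin N) R #{i | j < l i}) = 1 := by
  induction k with
  | zero =>
    rw [prod_range_zero, schurCoeff_one, if_pos]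
    exact funext fun i => Nat.min_zero _
  | succ k ih =>
    have hanti : Antitone fun i => min (l i) (k + 1) := fun i j hij => min_le_min_right _ (hl hij)
    have hstep (i : Fin N) : min (l i) (k + 1) =
        min (l i) k + if i ∈ ({i | k < l i} : Finset (Fin N)) then 1 else 0 := by
      simp only [mem_filter_univ]
      split_ifs <;> omega
    rw [prod_range_succ, schurCoeff_mul_esymm,
      sum_eq_single_of_mem ({i | k < l i} : Finset (Fin N)),
      schurCoeff_mul_prod_X_of_eq hstep, ih]
    · exact mem_powersetCard.2 ⟨subset_univ _, rfl⟩
    · intro S hS hne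
      by_contra hcoeff
      obtain ⟨μ, hμ, hlμ⟩ := exists_antitone_of_schurCoeff_mul_prod_X_ne_zero
        (isSymmetric_prod fun _ _ => esymm_isSymmetric _ _ _) hanti hcoeff
      rw [schurCoeff_mul_prod_X_of_eq hlμ] at hcoeff
      have hbound := (sum_le_sum_min_of_schurCoeff_prod_esymm_ne_zero _ k hμ hcoeff).1
      refine hne (eq_of_subset_of_card_le (fun i hi => ?_) (mem_powersetCard.1 hS).2.le).symm
      by_contra hiS
      have hli := hlμ i
      have hμi := hbound i
      rw [mem_filter_univ] at hi
      rw [if_neg hiS] at hli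
      omega

end ElementaryTriangularity

section LinearAlgebra

variable {ι Q K : Type*} [Fintype ι] [PartialOrder Q] [Field K]

theorem eq_zero_of_triangular {q : ι → Q} (hq : Function.Injective q) {M : ι → ι → K}
    (hM : ∀ μ ν, ¬ q μ ≤ q ν → M μ ν = 0) (hdiag : ∀ ν, M ν ν ≠ 0) {T : ι → Prop}
    (hT : ∀ μ ν, q μ ≤ q ν → T ν → T μ) {c : ι → K}
    (hc : ∀ ν, T ν → ∑ μ, c μ * M μ ν = 0) (ν : ι) (hν : T ν) : c ν = 0 := by
  have hwf : WellFounded fun a b => q a < q b :=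
    @Finite.wellFounded_of_trans_of_irrefl ι _ (fun a b => q a < q b)
      ⟨fun _ _ _ => lt_trans⟩ ⟨fun _ => lt_irrefl _⟩
  induction ν using hwf.induction with
  | _ ν ih =>
    have hsum := hc ν hν
    rw [sum_eq_single_of_mem ν (mem_univ ν)] at hsum
    · exact (mul_eq_zero.1 hsum).resolve_right (hdiag ν)
    · intro μ _ hne
      by_cases hle : q μ ≤ q ν
      · rw [ih μ (lt_of_le_of_ne hle fun he => hne (hq he)) (hT μ ν hle hν), zero_mul]
      · rw [hM μ ν hle, mul_zero]

omit [Fintype ι] in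
theorem span_eq_top_of_triangular [Finite ι] {q : ι → Q} (hq : Function.Injective q) {ψ : ι → ι → K}
    {H : ι → (ι → K) →ₗ[K] K} (hψ : ∀ μ ν, ¬ q μ ≤ q ν → H ν (ψ μ) = 0)
    (hdiag : ∀ ν, H ν (ψ ν) ≠ 0) : Submodule.span K (Set.range ψ) = ⊤ := by
  cases nonempty_fintype ι
  refine LinearIndependent.span_eq_top_of_card_eq_finrank' ?_ (by simp)
  rw [Fintype.linearIndependent_iff]
  intro c hc ν
  refine eq_zero_of_triangular hq (M := fun μ ν => H ν (ψ μ)) hψ hdiag (T := fun _ => True)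
    (fun _ _ _ h => h) (fun ν _ => ?_) ν trivial
  simpa only [map_sum, map_smul, smul_eq_mul, map_zero] using congrArg (H ν) hc

omit [Fintype ι] in
theorem eq_of_doubly_triangular [Finite ι] {q : ι → Q} (hq : Function.Injective q)
    {χ ψ : ι → ι → K} {H E : ι → (ι → K) →ₗ[K] K}
    (hχH : ∀ μ ν, ¬ q μ ≤ q ν → H ν (χ μ) = 0) (hχH_self : ∀ ν, H ν (χ ν) = 1)
    (hψH : ∀ μ ν, ¬ q μ ≤ q ν → H ν (ψ μ) = 0) (hψH_self : ∀ ν, H ν (ψ ν) = 1)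
    (hχE : ∀ μ ν, ¬ q ν ≤ q μ → E ν (χ μ) = 0) (hψE : ∀ μ ν, ¬ q ν ≤ q μ → E ν (ψ μ) = 0)
    (hψE_self : ∀ ν, E ν (ψ ν) ≠ 0) : χ = ψ := by
  have hdiag (ν : ι) : H ν (ψ ν) ≠ 0 := by rw [hψH_self]; exact one_ne_zero
  cases nonempty_fintype ι
  ext1 lam
  obtain ⟨t, ht⟩ := (Submodule.mem_span_range_iff_exists_fun K).1
    (span_eq_top_of_triangular hq hψH hdiag ▸ Submodule.mem_top :
      χ lam ∈ Submodule.span K (Set.range ψ))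
  have hexpand (L : (ι → K) →ₗ[K] K) : ∑ μ, t μ * L (ψ μ) = L (χ lam) := by
    simp only [← ht, map_sum, map_smul, smul_eq_mul]
  have hnot_ge (ν : ι) (hν : ¬ q lam ≤ q ν) : t ν = 0 :=
    eq_zero_of_triangular hq (M := fun μ ν => H ν (ψ μ)) hψH hdiag
      (T := fun ν => ¬ q lam ≤ q ν) (fun μ ν hle h h' => h (h'.trans hle))
      (fun ν hν => by rw [hexpand, hχH lam ν hν]) ν hν
  have hnot_le (ν : ι) (hν : ¬ q ν ≤ q lam) : t ν = 0 :=
    eq_zero_of_triangular (q := fun ν => OrderDual.toDual (q ν)) (fun a b h => hq h)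
      (M := fun μ ν => E ν (ψ μ)) hψE hψE_self (T := fun ν => ¬ q ν ≤ q lam)
      (fun μ ν hle h h' => h (le_trans hle h')) (fun ν hν => by rw [hexpand, hχE lam ν hν]) ν hν
  have hzero (ν : ι) (hne : ν ≠ lam) : t ν = 0 := by
    by_cases hle : q lam ≤ q ν
    · exact hnot_le ν fun hle' => hne (hq (le_antisymm hle' hle))
    · exact hnot_ge ν hle
  have hone : t lam = 1 := by
    rw [← hχH_self lam, ← hexpand (H lam), sum_eq_single_of_mem lam (mem_univ lam)
      fun μ _ hne => by rw [hzero μ hne, zero_mul], hψH_self, mul_one]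
  rw [← ht, sum_eq_single_of_mem lam (mem_univ lam) fun μ _ hne => by rw [hzero μ hne, zero_smul],
    hone, one_smul]

end LinearAlgebra

section RowLengths

variable {N : ℕ} (μ : YoungDiagram)

theorem rowLen_le_card (i : ℕ) : μ.rowLen i ≤ μ.card := by
  rw [YoungDiagram.rowLen_eq_card]
  exact card_filter_le _ _

theorem colLen_le_card (j : ℕ) : μ.colLen j ≤ μ.card := by
  rw [YoungDiagram.colLen_eq_card]
  exact card_filter_le _ _

variable {μ} in
theorem rowLen_eq_zero_of_colLen_le {i : ℕ} (hi : μ.colLen 0 ≤ i) : μ.rowLen i = 0 := by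
  by_contra h
  exact (YoungDiagram.mem_iff_lt_colLen.1
    (YoungDiagram.mem_iff_lt_rowLen.2 (Nat.pos_of_ne_zero h))).not_ge hi

variable {μ} in
theorem colLen_eq_zero_of_rowLen_le {j : ℕ} (hj : μ.rowLen 0 ≤ j) : μ.colLen j = 0 := by
  rw [← YoungDiagram.rowLen_transpose]
  exact rowLen_eq_zero_of_colLen_le (by rwa [YoungDiagram.colLen_transpose])

variable (N) in
/-- The first `N` row lengths of a Young diagram, the exponent vector of its Schur polynomial in
`N` variables. -/
def rowFun (i : Fin N) : ℕ := μ.rowLen i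

theorem antitone_rowFun : Antitone (rowFun N μ) := fun i j hij => μ.rowLen_anti i j hij

theorem truncate_rowLen : truncate N μ.rowLen N = rowFun N μ :=
  funext fun i => if_pos i.is_lt

theorem colWeight_eq_sum_colLen (m : ℕ) : colWeight μ m = ∑ j ∈ range m, μ.colLen j := by
  induction m with
  | zero => simp [colWeight]
  | succ m ih => rw [sum_range_succ, colWeight_succ, ih]

variable {μ}

theorem colWeight_eq_sum_min (hN : μ.colLen 0 ≤ N) (m : ℕ) :
    colWeight μ m = ∑ k ∈ range N, min (μ.rowLen k) m := by
  rw [colWeight, card_eq_sum_card_fiberwise (f := Prod.fst) (t := range N)]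
  · refine sum_congr rfl fun k _ => ?_
    rw [← card_fst_eq_and_snd_lt (Equiv.refl μ.cells), card_filter_equiv_cells _
      fun c => c.1 = k ∧ c.2 < m, filter_filter]
    simp only [and_comm]
  · rintro ⟨i, j⟩ hc
    have hmem := YoungDiagram.mem_iff_lt_colLen.1 ((YoungDiagram.mem_cells _).1 (mem_filter.1 hc).1)
    exact mem_coe.2 (mem_range.2 ((hmem.trans_le (μ.colLen_anti 0 j j.zero_le)).trans_le hN))

theorem colWeight_eq_sum_min_rowFun (hN : μ.colLen 0 ≤ N) (m : ℕ) :
    colWeight μ m = ∑ i, min (rowFun N μ i) m := by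
  rw [colWeight_eq_sum_min hN, sum_range]
  rfl

theorem card_lt_rowFun (hN : μ.colLen 0 ≤ N) (j : ℕ) : #{i | j < rowFun N μ i} = μ.colLen j := by
  have hiff (i : Fin N) : j < rowFun N μ i ↔ (i : ℕ) < μ.colLen j := by
    rw [rowFun, ← YoungDiagram.mem_iff_lt_rowLen, YoungDiagram.mem_iff_lt_colLen]
  simp only [hiff]
  rw [Fin.card_filter_val_lt, min_eq_right ((μ.colLen_anti 0 j j.zero_le).trans hN)]

theorem exists_youngDiagram_rowFun_eq {l : Fin N → ℕ} (hl : Antitone l) :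
    ∃ μ : YoungDiagram, μ.colLen 0 ≤ N ∧ rowFun N μ = l := by
  refine ⟨.ofRowLens (List.ofFn l) hl.sortedGE_ofFn, ?_, funext fun i => ?_⟩
  · by_contra! h
    obtain ⟨hlt, -⟩ := YoungDiagram.mem_ofRowLens.1 (YoungDiagram.mem_iff_lt_colLen.2 h)
    simp at hlt
  · simpa [rowFun] using YoungDiagram.rowLen_ofRowLens (hw := hl.sortedGE_ofFn)
      (Fin.cast List.length_ofFn.symm i)

end RowLengths

section Triangularity

variable {N : ℕ} {R : Type*} [CommRing R] [NoZeroDivisors R] [CharZero R] {μ ν : YoungDiagram}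

theorem schurCoeff_prod_hsymm_rowLen_eq_zero (hμ : μ.colLen 0 ≤ N) (hν : ν.colLen 0 ≤ N)
    (h : ¬ colWeight μ ≤ colWeight ν) :
    schurCoeff (rowFun N μ) (∏ i ∈ range N, hsymm (Fin N) R (ν.rowLen i)) = 0 := by
  by_contra hne
  refine h fun m => ?_
  rw [colWeight_eq_sum_min_rowFun hμ, colWeight_eq_sum_min hν]
  exact (sum_min_le_of_schurCoeff_prod_hsymm_ne_zero _ N (antitone_rowFun μ) hne).1 m

theorem schurCoeff_prod_hsymm_rowLen_self :
    schurCoeff (rowFun N μ) (∏ i ∈ range N, hsymm (Fin N) R (μ.rowLen i)) = 1 := by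
  rw [← truncate_rowLen]
  exact schurCoeff_truncate_prod_hsymm (fun i j hij => μ.rowLen_anti i j hij) le_rfl

theorem schurCoeff_prod_esymm_colLen_eq_zero (hμ : μ.colLen 0 ≤ N) {k : ℕ} (hν : ν.rowLen 0 ≤ k)
    (h : ¬ colWeight ν ≤ colWeight μ) :
    schurCoeff (rowFun N μ) (∏ j ∈ range k, esymm (Fin N) R (ν.colLen j)) = 0 := by
  by_contra hne
  obtain ⟨hbound, hsum, hmin⟩ :=
    sum_le_sum_min_of_schurCoeff_prod_esymm_ne_zero _ k (antitone_rowFun μ) hne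
  refine h fun m => ?_
  rw [colWeight_eq_sum_min_rowFun hμ, colWeight_eq_sum_colLen]
  rcases le_total m k with hm | hm
  · exact hmin m hm
  · rw [← sum_subset (range_subset_range.2 hm) fun j _ hj => colLen_eq_zero_of_rowLen_le
      (hν.trans (not_lt.1 fun h => hj (mem_range.2 h))), ← hsum]
    exact sum_le_sum fun i _ => le_min le_rfl ((hbound i).trans hm)

theorem schurCoeff_prod_esymm_colLen_self (hμ : μ.colLen 0 ≤ N) {k : ℕ} (hk : μ.rowLen 0 ≤ k) :
    schurCoeff (rowFun N μ) (∏ j ∈ range k, esymm (Fin N) R (μ.colLen j)) = 1 := by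
  have hmin : (fun i => min (rowFun N μ i) k) = rowFun N μ :=
    funext fun i => min_eq_left ((μ.rowLen_anti 0 i i.1.zero_le).trans hk)
  simpa only [hmin, card_lt_rowFun hμ] using
    schurCoeff_min_prod_esymm (R := R) (antitone_rowFun (N := N) μ) k

end Triangularity

section DiagramOfPartition

variable {n : ℕ} (lam : Nat.Partition n)

theorem rowLens_diagram : (diagram lam).rowLens = lam.parts.sort (· ≥ ·) :=
  YoungDiagram.rowLens_ofRowLens_eq_self fun _ hx => lam.parts_pos ((Multiset.mem_sort _).1 hx)

theorem diagram_injective : Function.Injective (diagram (n := n)) := by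
  intro lam mu h
  apply Nat.Partition.ext
  rw [← Multiset.sort_eq lam.parts (· ≥ ·), ← Multiset.sort_eq mu.parts (· ≥ ·),
    ← rowLens_diagram, ← rowLens_diagram, h]

theorem rowLen_diagram_le (i : ℕ) : (diagram lam).rowLen i ≤ n :=
  (rowLen_le_card _ i).trans (card_cells lam).le

theorem colLen_diagram_le (j : ℕ) : (diagram lam).colLen j ≤ n :=
  (colLen_le_card _ j).trans (card_cells lam).le

theorem exists_diagram_eq {μ : YoungDiagram} (hμ : μ.rowLens.sum = n) :
    ∃ lam : Nat.Partition n, diagram lam = μ := by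
  refine ⟨⟨μ.rowLens, fun hi => μ.pos_of_mem_rowLens _ hi, hμ⟩, ?_⟩
  apply YoungDiagram.equivListRowLens.injective
  apply Subtype.ext
  change (diagram _).rowLens = μ.rowLens
  rw [rowLens_diagram]
  exact List.mergeSort_eq_self _ μ.rowLens_sorted.pairwise

theorem sum_rowLens {N : ℕ} {μ : YoungDiagram} (hN : μ.colLen 0 ≤ N) :
    μ.rowLens.sum = ∑ i, rowFun N μ i := by
  simp only [rowFun]
  rw [← sum_range, ← sum_subset (range_subset_range.2 hN)]
  · rfl
  · exact fun i _ hi => rowLen_eq_zero_of_colLen_le (not_lt.1 fun h => hi (mem_range.2 h))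

theorem sum_rowFun_diagram {N : ℕ} (hN : n ≤ N) : ∑ i, rowFun N (diagram lam) i = n := by
  rw [← sum_rowLens ((colLen_diagram_le lam 0).trans hN), rowLens_diagram, ← Multiset.sum_coe,
    Multiset.sort_eq, lam.parts_sum]

theorem exists_rowFun_diagram_eq {N : ℕ} {l : Fin N → ℕ} (hl : Antitone l) (hn : ∑ i, l i = n) :
    ∃ lam : Nat.Partition n, rowFun N (diagram lam) = l := by
  obtain ⟨μ, hμ, rfl⟩ := exists_youngDiagram_rowFun_eq hl
  obtain ⟨lam, rfl⟩ := exists_diagram_eq ((sum_rowLens hμ).trans hn)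
  exact ⟨lam, rfl⟩

theorem count_parts {N : ℕ} (hN : n ≤ N) {v : ℕ} (hv : v ≠ 0) :
    lam.parts.count v = #{i | rowFun N (diagram lam) i = v} := by
  have hparts : lam.parts = (Multiset.range ((diagram lam).colLen 0)).map (diagram lam).rowLen := by
    rw [← Multiset.sort_eq lam.parts (· ≥ ·), ← rowLens_diagram]
    rfl
  have hrange : #{i | rowFun N (diagram lam) i = v} =
      #{i ∈ range N | (diagram lam).rowLen i = v} := by
    rw [card_filter, card_filter, sum_range]
    rfl
  have hfilter : {i ∈ range N | (diagram lam).rowLen i = v} =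
      {i ∈ range ((diagram lam).colLen 0) | v = (diagram lam).rowLen i} := by
    ext i
    simp only [mem_filter, mem_range, eq_comm (a := v)]
    refine and_congr_left fun h => ⟨fun _ => ?_, fun hi =>
      hi.trans_le ((colLen_diagram_le lam 0).trans hN)⟩
    by_contra! hi
    exact hv (h ▸ rowLen_eq_zero_of_colLen_le hi)
  rw [hrange, hfilter, hparts, Multiset.count_map]
  rfl

theorem colLen_eq_colLen_succ_add_count (j : ℕ) :
    (diagram lam).colLen j = (diagram lam).colLen (j + 1) + lam.parts.count (j + 1) := by
  have hN := colLen_diagram_le lam 0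
  rw [← card_lt_rowFun hN, ← card_lt_rowFun hN, count_parts lam le_rfl j.succ_ne_zero,
    ← card_union_of_disjoint (disjoint_filter.2 fun i _ h => h.ne'), ← filter_or]
  exact congrArg card (filter_congr fun i _ => by omega)

theorem forall_conjParts_even_iff :
    (∀ k ∈ conjParts lam, Even k) ↔ ∀ j, Even ((diagram lam).colLen j) := by
  simp only [conjParts, YoungDiagram.rowLens, YoungDiagram.colLen_transpose,
    Multiset.mem_coe, List.mem_map, List.mem_range, YoungDiagram.rowLen_transpose]
  constructor
  · intro h j
    rcases lt_or_ge j ((diagram lam).rowLen 0) with hj | hj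
    · exact h _ ⟨j, hj, rfl⟩
    · exact colLen_eq_zero_of_rowLen_le hj ▸ Even.zero
  · rintro h _ ⟨j, -, rfl⟩
    exact h j

theorem forall_even_colLen_iff :
    (∀ j, Even ((diagram lam).colLen j)) ↔ ∀ i ∈ Icc 1 n, Even (lam.parts.count i) := by
  constructor
  · intro h i hi
    obtain ⟨j, rfl⟩ := Nat.exists_eq_add_of_le' (mem_Icc.1 hi).1
    exact (Nat.even_add.1 (colLen_eq_colLen_succ_add_count lam j ▸ h j)).1 (h (j + 1))
  · intro h j
    have hzero (j : ℕ) (hj : n ≤ j) : Even ((diagram lam).colLen j) :=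
      colLen_eq_zero_of_rowLen_le ((rowLen_diagram_le lam 0).trans hj) ▸ Even.zero
    rcases le_total n j with hj | hj
    · exact hzero j hj
    · induction hj using Nat.decreasingInduction with
      | self => exact hzero n le_rfl
      | of_succ j hj ih =>
        rw [colLen_eq_colLen_succ_add_count]
        exact ih.add (h _ (mem_Icc.2 ⟨by omega, hj⟩))

end DiagramOfPartition

section CycleProducts

theorem prod_map_smul {ι R A : Type*} [CommSemiring R] [CommSemiring A] [Algebra R A]
    (m : Multiset ι) (c : ι → R) (p : ι → A) :
    (m.map fun k => c k • p k).prod = (m.map c).prod • (m.map p).prod := by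
  simp only [Algebra.smul_def, Multiset.prod_map_mul, map_multiset_prod, Multiset.map_map,
    Function.comp_apply]

theorem prod_map_neg_pow {R : Type*} [CommRing R] (s : R) (m : Multiset ℕ) :
    (m.map fun k => -s ^ k).prod = (-1) ^ m.card * s ^ m.sum := by
  induction m using Multiset.induction_on with
  | empty => simp
  | cons k m ih =>
    rw [Multiset.map_cons, Multiset.prod_cons, ih, Multiset.sum_cons, Multiset.card_cons]
    ring

variable {α R : Type*} [Fintype α] [DecidableEq α] [CommRing R]

theorem cycleProd_smul {A : Type*} [CommRing A] [Algebra R A] (c : ℕ → R) (P : ℕ → A)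
    (g : Equiv.Perm α) : cycleProd (fun k => c k • P k) g = cycleProd c g • cycleProd P g :=
  prod_map_smul _ _ _

theorem cycleProd_neg_neg_one_pow (g : Equiv.Perm α) :
    cycleProd (fun k => -(-1 : R) ^ k) g = ((Equiv.Perm.sign g : ℤ) : R) := by
  rw [cycleProd, Equiv.Perm.parts_partition, Multiset.map_add, Multiset.prod_add,
    prod_map_neg_pow, Equiv.Perm.sign_of_cycleType, pow_add]
  simp [mul_comm]

theorem sum_map_cycleProd_map_eq {ι S : Type*} [DecidableEq ι] [CommRing S] [Algebra ℚ R]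
    (L : R →+ S) (P : ℕ → R) {f : α → ι} [DecidablePred fun g : Equiv.Perm α => ∀ i, f (g i) = f i]
    {s : Finset ι} (hf : ∀ i, f i ∈ s) :
    ∑ g : Equiv.Perm α with ∀ i, f (g i) = f i, L (cycleProd P g) =
      Fintype.card (fiberSubgroup f) * L (∏ j ∈ s, cycleExp P #{i | f i = j}) := by
  have hsum := congrArg L (sum_cycleProd_map_eq P hf)
  rw [map_sum, ← nsmul_eq_mul, map_nsmul, nsmul_eq_mul] at hsum
  rw [Fintype.card_of_subtype {g : Equiv.Perm α | ∀ i, f (g i) = f i}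
    fun g => by rw [mem_filter_univ, mem_fiberSubgroup]]
  convert hsum

end CycleProducts

section Frobenius

variable {n : ℕ}

theorem rowOf_lt (lam : Nat.Partition n) (i : Fin n) : rowOf lam i < n :=
  (YoungDiagram.mem_iff_lt_colLen.1
    ((YoungDiagram.mem_cells _).1 ((tableau lam).symm i).2)).trans_le (colLen_diagram_le lam _)

theorem colOf_lt (lam : Nat.Partition n) (i : Fin n) : colOf lam i < n :=
  (YoungDiagram.mem_iff_lt_rowLen.1
    ((YoungDiagram.mem_cells _).1 ((tableau lam).symm i).2)).trans_le (rowLen_diagram_le lam _)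

/-- The cycle type of a permutation of `Fin n`, as a partition of `n`, whereas
`Equiv.Perm.partition` is a partition of `Fintype.card (Fin n)`. -/
def permType (g : Equiv.Perm (Fin n)) : Nat.Partition n where
  parts := g.partition.parts
  parts_pos := g.partition.parts_pos
  parts_sum := g.partition.parts_sum.trans (Fintype.card_fin n)

theorem chi_permType (lam : Nat.Partition n) (g : Equiv.Perm (Fin n)) :
    chi lam (permType g) = (spechtRep lam).character g := chi_eq lam _ g rfl

/-- The right-hand side of the Frobenius character formula: the coefficient of `x ^ (μ + δ)` in
the product of the alternant and the power sum symmetric polynomial `p_π` in `N` variables. -/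
noncomputable def frobeniusCoeff (N : ℕ) (μ : YoungDiagram) (π : Nat.Partition n) : ℂ :=
  schurCoeff (rowFun N μ) (π.parts.map (psum (Fin N) ℂ)).prod

theorem frobeniusCoeff_permType (N : ℕ) (μ : YoungDiagram) (g : Equiv.Perm (Fin n)) :
    frobeniusCoeff N μ (permType g) = schurCoeff (rowFun N μ) (cycleProd (psum (Fin N) ℂ) g) := rfl

variable (nu : Nat.Partition n)

/-- The average of a class function over the row stabilizer of the tableau of `nu`, that is, its
inner product with the permutation character of that Young subgroup. -/
noncomputable def rowAverage : (Nat.Partition n → ℂ) →ₗ[ℂ] ℂ :=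
  (Fintype.card (fiberSubgroup (rowOf nu)) : ℂ)⁻¹ •
    ∑ g : Equiv.Perm (Fin n) with ∀ i, rowOf nu (g i) = rowOf nu i, LinearMap.proj (permType g)

/-- The sum of a class function against the sign over the column stabilizer of the tableau
of `nu`. -/
noncomputable def colAlternation : (Nat.Partition n → ℂ) →ₗ[ℂ] ℂ :=
  ∑ g : Equiv.Perm (Fin n) with ∀ i, colOf nu (g i) = colOf nu i,
    ((Equiv.Perm.sign g : ℤ) : ℂ) • LinearMap.proj (permType g)

theorem rowAverage_apply (F : Nat.Partition n → ℂ) :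
    rowAverage nu F = (Fintype.card (fiberSubgroup (rowOf nu)) : ℂ)⁻¹ *
      ∑ g : Equiv.Perm (Fin n) with ∀ i, rowOf nu (g i) = rowOf nu i, F (permType g) := by
  simp only [rowAverage, LinearMap.smul_apply, LinearMap.sum_apply, LinearMap.proj_apply,
    smul_eq_mul]

theorem colAlternation_apply (F : Nat.Partition n → ℂ) :
    colAlternation nu F = ∑ g : Equiv.Perm (Fin n) with ∀ i, colOf nu (g i) = colOf nu i,
      ((Equiv.Perm.sign g : ℤ) : ℂ) * F (permType g) := by
  simp only [colAlternation, LinearMap.smul_apply, LinearMap.sum_apply, LinearMap.proj_apply,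
    smul_eq_mul]

theorem rowAverage_chi (lam : Nat.Partition n) :
    rowAverage nu (chi lam) =
      (Fintype.card (fiberSubgroup (rowOf nu)) : ℂ)⁻¹ * spechtTrace lam (rowSymmetrizer nu) := by
  simp only [rowAverage_apply, spechtTrace_rowSymmetrizer, chi_permType]

theorem colAlternation_chi (lam : Nat.Partition n) :
    colAlternation nu (chi lam) = spechtTrace lam (colAntisymmetrizer nu) := by
  simp only [colAlternation_apply, spechtTrace_colAntisymmetrizer, chi_permType]

variable {N : ℕ} (hN : n ≤ N) (μ : YoungDiagram)
include hN

theorem rowAverage_frobeniusCoeff :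
    rowAverage nu (frobeniusCoeff N μ) =
      schurCoeff (rowFun N μ) (∏ i ∈ range N, hsymm (Fin N) ℂ ((diagram nu).rowLen i)) := by
  have hcard (k : ℕ) : #{i | rowOf nu i = k} = (diagram nu).rowLen k :=
    card_fst_eq (tableau nu).symm k
  have hsum := sum_map_cycleProd_map_eq (schurCoeff (rowFun N μ)).toAddMonoidHom
    (psum (Fin N) ℂ) fun i => mem_range.2 ((rowOf_lt nu i).trans_le hN)
  simp only [hcard, cycleExp_psum, LinearMap.toAddMonoidHom_coe] at hsum
  simp only [rowAverage_apply, frobeniusCoeff_permType]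
  rw [hsum, inv_mul_cancel_left₀ (Nat.cast_ne_zero.2 Fintype.card_ne_zero)]

theorem colAlternation_frobeniusCoeff :
    colAlternation nu (frobeniusCoeff N μ) = Fintype.card (fiberSubgroup (colOf nu)) *
      schurCoeff (rowFun N μ) (∏ j ∈ range N, esymm (Fin N) ℂ ((diagram nu).colLen j)) := by
  have hcard (k : ℕ) : #{i | colOf nu i = k} = (diagram nu).colLen k :=
    card_snd_eq (tableau nu).symm k
  have hsum := sum_map_cycleProd_map_eq (schurCoeff (rowFun N μ)).toAddMonoidHom
    (fun k => -(-1 : ℂ) ^ k • psum (Fin N) ℂ k)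
    fun i => mem_range.2 ((colOf_lt nu i).trans_le hN)
  simp only [hcard, cycleExp_neg_psum, one_pow, one_smul, LinearMap.toAddMonoidHom_coe,
    cycleProd_smul, cycleProd_neg_neg_one_pow, map_smul, smul_eq_mul] at hsum
  simp only [colAlternation_apply, frobeniusCoeff_permType]
  exact hsum

theorem chi_eq_frobeniusCoeff (lam : Nat.Partition n) :
    chi lam = frobeniusCoeff N (diagram lam) := by
  have hcol (nu : Nat.Partition n) : (diagram nu).colLen 0 ≤ N := (colLen_diagram_le nu 0).trans hN
  have hrow (nu : Nat.Partition n) : (diagram nu).rowLen 0 ≤ N := (rowLen_diagram_le nu 0).trans hN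
  have hstab (nu : Nat.Partition n) : (Fintype.card (fiberSubgroup (rowOf nu)) : ℂ) ≠ 0 :=
    Nat.cast_ne_zero.2 Fintype.card_ne_zero
  refine congrFun (eq_of_doubly_triangular (q := fun nu => colWeight (diagram nu))
    (χ := chi) (ψ := fun nu => frobeniusCoeff N (diagram nu))
    (H := rowAverage) (E := colAlternation) (colWeight_injective.comp diagram_injective)
    (fun mu nu h => ?_) (fun nu => ?_) (fun mu nu h => ?_) (fun nu => ?_) (fun mu nu h => ?_)
    (fun mu nu h => ?_) fun nu => ?_) lam
  · rw [rowAverage_chi, spechtTrace_rowSymmetrizer_eq_zero h, mul_zero]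
  · rw [rowAverage_chi, spechtTrace_rowSymmetrizer_self, inv_mul_cancel₀ (hstab nu)]
  · rw [rowAverage_frobeniusCoeff nu hN,
      schurCoeff_prod_hsymm_rowLen_eq_zero (hcol mu) (hcol nu) h]
  · rw [rowAverage_frobeniusCoeff nu hN, schurCoeff_prod_hsymm_rowLen_self]
  · rw [colAlternation_chi, spechtTrace_colAntisymmetrizer_eq_zero h]
  · rw [colAlternation_frobeniusCoeff nu hN,
      schurCoeff_prod_esymm_colLen_eq_zero (hcol mu) (hrow nu) h, mul_zero]
  · rw [colAlternation_frobeniusCoeff nu hN, schurCoeff_prod_esymm_colLen_self (hcol nu) (hrow nu),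
      mul_one]
    exact Nat.cast_ne_zero.2 Fintype.card_ne_zero

end Frobenius

section Removable

/-- The sets of rows of a partition with row lengths `l` whose last boxes can be removed
simultaneously, i.e. the vertical strips: they are final segments of the blocks of equal nonzero
rows. -/
def IsRemovable {ι : Type*} [LE ι] (l : ι → ℕ) (S : Finset ι) : Prop :=
  (∀ i ∈ S, l i ≠ 0) ∧ ∀ i j, i ≤ j → l i = l j → i ∈ S → j ∈ S

theorem isRemovable_iff {ι : Type*} [Preorder ι] [DecidableEq ι] {l : ι → ℕ} (hl : Antitone l)
    (S : Finset ι) :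
    IsRemovable l S ↔ ∃ μ : ι → ℕ, Antitone μ ∧ ∀ i, l i = μ i + if i ∈ S then 1 else 0 := by
  constructor
  · rintro ⟨h₀, h⟩
    refine ⟨fun i => l i - if i ∈ S then 1 else 0, fun i j hij => ?_, fun i => ?_⟩
    · have := hl hij
      have := h i j hij
      grind
    · have := h₀ i
      grind
  · rintro ⟨μ, hμ, h⟩
    refine ⟨fun i hi => ?_, fun i j hij hlij hi => by_contra fun hj => ?_⟩
    · rw [h i, if_pos hi]
      omega
    · have := hμ hij
      grind

variable {ι κ R : Type*} [DecidableEq κ] [CommSemiring R]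

section UpperSubsets

variable [LinearOrder ι]

/-- The subsets of the finset `B` that are final segments of it. -/
def upperSubsets (B : Finset ι) : Finset (Finset ι) :=
  {T ∈ B.powerset | ∀ i ∈ B, ∀ j ∈ B, i ≤ j → i ∈ T → j ∈ T}

theorem mem_upperSubsets {B T : Finset ι} :
    T ∈ upperSubsets B ↔ T ⊆ B ∧ ∀ i ∈ B, ∀ j ∈ B, i ≤ j → i ∈ T → j ∈ T := by
  rw [upperSubsets, mem_filter, mem_powerset]

theorem upperSubsets_insert {a : ι} {B : Finset ι} (ha : ∀ b ∈ B, a < b) :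
    upperSubsets (insert a B) = insert (insert a B) (upperSubsets B) := by
  ext T
  simp only [mem_upperSubsets, mem_insert]
  constructor
  · rintro ⟨hT, h⟩
    by_cases haT : a ∈ T
    · refine Or.inl (hT.antisymm fun j hj => h a (Or.inl rfl) j (mem_insert.1 hj) ?_ haT)
      exact (mem_insert.1 hj).elim (fun hja => hja.ge) fun hjB => (ha j hjB).le
    · exact Or.inr ⟨(subset_insert_iff_of_notMem haT).1 hT,
        fun i hi j hj => h i (Or.inr hi) j (Or.inr hj)⟩
  · rintro (rfl | ⟨hT, h⟩)
    · exact ⟨Subset.rfl, fun i _ j hj _ _ => mem_insert.2 hj⟩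
    · refine ⟨hT.trans (subset_insert _ _), ?_⟩
      rintro i hi j (rfl | hj) hij hiT
      · exact absurd (ha i (hT hiT)) hij.not_gt
      · exact h i (hT hiT) j hj hij hiT

theorem sum_pow_card_upperSubsets (s : R) (B : Finset ι) :
    ∑ T ∈ upperSubsets B, s ^ #T = ∑ j ∈ range (#B + 1), s ^ j := by
  induction B using Finset.induction_on_min with
  | empty => simp [upperSubsets]
  | insert a B hlt ih =>
    have ha : a ∉ B := fun h => lt_irrefl _ (hlt a h)
    have hB : insert a B ∉ upperSubsets B := fun h =>
      ha ((mem_upperSubsets.1 h).1 (mem_insert_self a B))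
    rw [upperSubsets_insert hlt, sum_insert hB, card_insert_of_notMem ha, sum_range_succ, ih,
      add_comm]

end UpperSubsets

theorem sum_pow_card_eq_prod_fiber [Fintype ι] [DecidableEq ι] (s : R) (f : ι → κ) (V : Finset κ)
    (t : κ → Finset (Finset ι)) (ht : ∀ v, ∀ T ∈ t v, ∀ i ∈ T, f i = v) :
    ∑ S : Finset ι with (∀ i ∈ S, f i ∈ V) ∧ ∀ v ∈ V, ({i ∈ S | f i = v} : Finset ι) ∈ t v,
      s ^ #S = ∏ v ∈ V, ∑ T ∈ t v, s ^ #T := by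
  induction V using Finset.induction_on with
  | empty =>
    rw [prod_empty, ← pow_zero s, ← card_empty (α := ι), ← sum_singleton (fun S => s ^ #S)]
    congr 1
    ext S
    simp [eq_empty_iff_forall_notMem]
  | insert v V hv ih =>
    have hT {T S : Finset ι} (hTv : T ∈ t v) (hSV : ∀ i ∈ S, f i ∈ V) :
        ({i ∈ T ∪ S | f i = v} : Finset ι) = T ∧ ({i ∈ T ∪ S | f i ≠ v} : Finset ι) = S := by
      grind
    rw [prod_insert hv, ← ih, sum_mul_sum, ← sum_product']
    symm
    refine sum_bij' (fun p _ => p.1 ∪ p.2)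
      (fun S _ => ({i ∈ S | f i = v}, {i ∈ S | f i ≠ v})) ?_ ?_ ?_ ?_ ?_
    · rintro ⟨T, S⟩ hTS
      simp only [mem_product, mem_filter_univ, forall_mem_insert] at hTS ⊢
      obtain ⟨hTv, hSV, hSt⟩ := hTS
      refine ⟨by grind, by rwa [(hT hTv hSV).1], fun w hw => ?_⟩
      convert hSt w hw using 1
      grind
    · intro S hS
      simp only [mem_product, mem_filter_univ, forall_mem_insert] at hS ⊢
      refine ⟨hS.2.1, by grind, fun w hw => ?_⟩
      convert hS.2.2 w hw using 1
      grind
    · rintro ⟨T, S⟩ hTS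
      simp only [mem_product, mem_filter_univ] at hTS
      exact Prod.ext (hT hTS.1 hTS.2.1).1 (hT hTS.1 hTS.2.1).2
    · intro S _
      exact filter_union_filter_not_eq _ S
    · rintro ⟨T, S⟩ hTS
      simp only [mem_product, mem_filter_univ] at hTS
      rw [← pow_add, card_union_of_disjoint (disjoint_left.2 fun i hiT hiS => ?_)]
      exact hv (ht v T hTS.1 i hiT ▸ hTS.2.1 i hiS)

theorem isRemovable_iff_fiber [Fintype ι] [LinearOrder ι] {l : ι → ℕ} {n : ℕ}
    (hl : ∀ i, l i ≤ n) (S : Finset ι) :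
    IsRemovable l S ↔ (∀ i ∈ S, l i ∈ Icc 1 n) ∧
      ∀ v ∈ Icc 1 n, ({i ∈ S | l i = v} : Finset ι) ∈ upperSubsets {i | l i = v} := by
  simp only [IsRemovable, mem_upperSubsets]
  constructor
  · rintro ⟨h₀, h⟩
    exact ⟨by grind, fun v _ => ⟨by grind, by grind⟩⟩
  · rintro ⟨h₀, h⟩
    refine ⟨by grind, fun i j hij hlij hi => ?_⟩
    have := (h (l i) (h₀ i hi)).2 i (by simp) j (by simp [hlij]) hij (by simp [hi])
    exact (mem_filter.1 this).1

theorem sum_pow_card_isRemovable [Fintype ι] [LinearOrder ι] (s : R) {l : ι → ℕ}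
    [DecidablePred (IsRemovable l)] {n : ℕ} (hl : ∀ i, l i ≤ n) :
    ∑ S with IsRemovable l S, s ^ #S =
      ∏ v ∈ Icc 1 n, ∑ j ∈ range (#{i | l i = v} + 1), s ^ j := by
  have ht (v : ℕ) : ∀ T ∈ upperSubsets {i | l i = v}, ∀ i ∈ T, l i = v := fun T hT i hi => by
    simpa using (mem_upperSubsets.1 hT).1 hi
  simp only [← sum_pow_card_upperSubsets, ← sum_pow_card_eq_prod_fiber s l (Icc 1 n) _ ht]
  simp only [isRemovable_iff_fiber hl]

end Removable

section Parity

theorem parity_eq_neg_one_pow (a : Multiset ℕ) : parity a = (-1) ^ (a.card + a.sum) := by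
  induction a using Multiset.induction_on with
  | empty => rfl
  | cons k a ih =>
    rw [parity] at ih ⊢
    rw [Multiset.sum_cons, Multiset.card_cons, add_comm k, add_add_add_comm, pow_add _ _ (1 + k),
      Multiset.countP_cons, pow_add, ih]
    rcases Nat.even_or_odd k with hk | hk <;>
      simp [hk, hk.neg_one_pow, Nat.not_even_iff_odd.2, pow_add]

theorem parity_add (a b : Multiset ℕ) : parity (a + b) = parity a * parity b := by
  rw [parity, parity, parity, Multiset.countP_add, pow_add]

theorem sum_map_two_mul (a : Multiset ℕ) : (a.map (2 * ·)).sum = 2 * a.sum := by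
  rw [Multiset.sum_map_mul_left, Multiset.map_id']

theorem parity_map_two_mul (c : Multiset ℕ) : parity (c.map (2 * ·)) = (-1) ^ c.card := by
  rw [parity_eq_neg_one_pow, sum_map_two_mul, Multiset.card_map, pow_add,
    (even_two_mul _).neg_one_pow, mul_one]

theorem parity_two_nsmul (d : Multiset ℕ) : parity (2 • d) = 1 := by
  rw [two_nsmul, parity_add, parity, ← pow_add, (Even.add_self _).neg_one_pow]

theorem prod_map_neg_neg_pow {R : Type*} [CommRing R] (s : R) (a : Multiset ℕ) :
    (a.map fun k => -(-s) ^ k).prod = parity a * s ^ a.sum := by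
  rw [prod_map_neg_pow, parity_eq_neg_one_pow, neg_pow s, ← mul_assoc, ← pow_add]
  push_cast
  rfl

end Parity

section TruncatedSums

theorem sum_partitionsUpTo {M : Type*} [AddCommMonoid M] {n m : ℕ} (hm : m ≤ n)
    (f : Multiset ℕ → M) :
    ∑ a ∈ partitionsUpTo n with m = a.sum, f a = ∑ π : Nat.Partition m, f π.parts := by
  symm
  refine sum_bij (fun π _ => π.parts) (fun π _ => ?_) (fun π _ π' _ h => Nat.Partition.ext h)
    (fun a ha => ?_) fun _ _ => rfl
  · rw [mem_filter, mem_partitionsUpTo, π.parts_sum]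
    exact ⟨⟨fun i hi => π.parts_pos hi, hm⟩, rfl⟩
  · rw [mem_filter, mem_partitionsUpTo] at ha
    exact ⟨⟨a, fun {i} hi => ha.1.1 i hi, ha.2.symm⟩, mem_univ _, rfl⟩

theorem map_two_mul_map_half {b : Multiset ℕ} (hb : ∀ k ∈ b, Even k) :
    (b.map (· / 2)).map (2 * ·) = b := by
  rw [Multiset.map_map]
  exact (Multiset.map_congr rfl fun k hk => Nat.two_mul_div_two_of_even (hb k hk)).trans
    (Multiset.map_id b)

theorem sum_partitionsUpTo_map_two_mul {M : Type*} [AddCommMonoid M] {n m : ℕ} (hm : m ≤ n)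
    (f : Multiset ℕ → M) :
    ∑ a ∈ partitionsUpTo n with m = 2 * a.sum, f (a.map (2 * ·)) =
      ∑ a ∈ partitionsUpTo n with m = a.sum ∧ ∀ k ∈ a, Even k, f a := by
  refine sum_bij' (fun a _ => a.map (2 * ·)) (fun b _ => b.map (· / 2)) (fun a ha => ?_)
    (fun b hb => ?_) (fun a _ => ?_) (fun b hb => ?_) fun _ _ => rfl
  · simp only [mem_filter, mem_partitionsUpTo, sum_map_two_mul, Multiset.forall_mem_map_iff]
      at ha ⊢
    exact ⟨⟨fun k hk => Nat.mul_pos two_pos (ha.1.1 k hk), ha.2 ▸ hm⟩, ha.2,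
      fun k _ => even_two_mul k⟩
  · simp only [mem_filter, mem_partitionsUpTo, Multiset.forall_mem_map_iff] at hb ⊢
    have hsum := sum_map_two_mul (b.map (· / 2))
    rw [map_two_mul_map_half hb.2.2] at hsum
    refine ⟨⟨fun k hk => ?_, by omega⟩, by omega⟩
    have := hb.1.1 k hk
    obtain ⟨j, rfl⟩ := hb.2.2 k hk
    omega
  · simp
  · exact map_two_mul_map_half (mem_filter.1 hb).2.2

theorem coeff_mul_eq_of_le {R : Type*} [Semiring R] {f f' g g' : PowerSeries R} {n : ℕ}
    (hf : ∀ m ≤ n, PowerSeries.coeff m f = PowerSeries.coeff m f')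
    (hg : ∀ m ≤ n, PowerSeries.coeff m g = PowerSeries.coeff m g') :
    ∀ m ≤ n, PowerSeries.coeff m (f * g) = PowerSeries.coeff m (f' * g') := by
  intro m hm
  rw [PowerSeries.coeff_mul, PowerSeries.coeff_mul]
  refine sum_congr rfl fun p hp => ?_
  rw [HasAntidiagonal.mem_antidiagonal] at hp
  rw [hf p.1 (by omega), hg p.2 (by omega)]

variable {R : Type*} [CommRing R] [Algebra ℚ R]

theorem coeff_sum_partitionsUpTo (P : ℕ → R) {n m : ℕ} (hm : m ≤ n) :
    PowerSeries.coeff m (∑ a ∈ partitionsUpTo n,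
      PowerSeries.monomial a.sum ((zee a : ℚ)⁻¹ • (a.map P).prod)) =
    PowerSeries.coeff m (expSeries P) := by
  rw [map_sum, coeff_expSeries, cycleExp,
    ← sum_partitionsUpTo hm fun a => (zee a : ℚ)⁻¹ • (a.map P).prod, sum_filter]
  exact sum_congr rfl fun a _ => PowerSeries.coeff_monomial _ _ _

theorem coeff_sum_even_partitionsUpTo (P : ℕ → R) {n m : ℕ} (hm : m ≤ n) :
    PowerSeries.coeff m (∑ a ∈ partitionsUpTo n,
      PowerSeries.monomial (2 * a.sum)
        ((zee (a.map (2 * ·)) : ℚ)⁻¹ • (a.map fun k => P (2 * k)).prod)) =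
    PowerSeries.coeff m (expSeries fun k => if Even k then P k else 0) := by
  let term (a : Multiset ℕ) : R := (zee a : ℚ)⁻¹ • (a.map fun k => if Even k then P k else 0).prod
  have hterm (a : Multiset ℕ) : (zee (a.map (2 * ·)) : ℚ)⁻¹ • (a.map fun k => P (2 * k)).prod =
      term (a.map (2 * ·)) := by
    simp [term]
  have hne (a : Multiset ℕ) (ha : term a ≠ 0) : ∀ k ∈ a, Even k := by
    refine fun k hk => by_contra fun hodd => ha ?_
    simp only [term]
    rw [Multiset.prod_eq_zero (Multiset.mem_map.2 ⟨k, hk, if_neg hodd⟩), smul_zero]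
  simp only [hterm, map_sum, PowerSeries.coeff_monomial]
  rw [← sum_filter, sum_partitionsUpTo_map_two_mul hm term, ← filter_filter,
    sum_filter_of_ne fun a _ => hne a, sum_partitionsUpTo hm, coeff_expSeries, cycleExp]

end TruncatedSums

section Quadruples

/-- The coefficients `C_π` and `D_π` in a uniform way: they are the values at `s = 1` and `s = -1`
of the weighted count of quadruples in which `ρ₋` contributes `s ^ |ρ₋|`. -/
noncomputable def coeffSign (s : ℂ) (m : Multiset ℕ) : ℂ :=
  ∑ q ∈ quadruples m, s ^ q.2.1.sum * quadWeight q

theorem coeffSign_one (m : Multiset ℕ) : coeffSign 1 m = coeffC m := by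
  simp only [coeffSign, coeffC, Cplus, Cminus, one_pow, one_mul, ← Nat.not_even_iff_odd]
  rw [sum_filter_add_sum_filter_not]

theorem coeffSign_neg_one (m : Multiset ℕ) : coeffSign (-1) m = coeffD m := by
  simp only [coeffSign, coeffD, Cplus, Cminus, ← Nat.not_even_iff_odd]
  rw [← sum_filter_add_sum_filter_not (quadruples m) (fun q => Even q.2.1.sum),
    sub_eq_add_neg, ← sum_neg_distrib]
  congr 1
  · refine sum_congr rfl fun q hq => ?_
    rw [(mem_filter.1 hq).2.neg_one_pow, one_mul]
  · refine sum_congr rfl fun q hq => ?_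
    rw [(Nat.not_even_iff_odd.1 (mem_filter.1 hq).2).neg_one_pow, neg_one_mul]

theorem sum_quadruple_union (q : Multiset ℕ × Multiset ℕ × Multiset ℕ × Multiset ℕ) :
    (q.1 + q.2.1 + q.2.2.1.map (2 * ·) + 2 • q.2.2.2).sum =
      q.1.sum + (q.2.1.sum + (2 * q.2.2.1.sum + 2 * q.2.2.2.sum)) := by
  simp only [Multiset.sum_add, sum_map_two_mul, Multiset.sum_nsmul, smul_eq_mul, add_assoc]

theorem sum_quadruples {n : ℕ} {M : Type*} [AddCommMonoid M]
    (f : Multiset ℕ × Multiset ℕ × Multiset ℕ × Multiset ℕ → M) :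
    ∑ π : Nat.Partition n, ∑ q ∈ quadruples π.parts, f q =
      ∑ q ∈ partitionsUpTo n ×ˢ partitionsUpTo n ×ˢ partitionsUpTo n ×ˢ partitionsUpTo n with
        n = q.1.sum + (q.2.1.sum + (2 * q.2.2.1.sum + 2 * q.2.2.2.sum)), f q := by
  let union (q : Multiset ℕ × Multiset ℕ × Multiset ℕ × Multiset ℕ) : Multiset ℕ :=
    q.1 + q.2.1 + q.2.2.1.map (2 * ·) + 2 • q.2.2.2
  simp only [← sum_quadruple_union]
  rw [← sum_fiberwise_of_maps_to (t := univ.image Nat.Partition.parts) (g := union),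
    sum_image fun _ _ _ _ h => Nat.Partition.ext h]
  · refine sum_congr rfl fun π _ => sum_congr ?_ fun _ _ => rfl
    rw [filter_filter, quadruples, π.parts_sum]
    exact filter_congr fun q _ => ⟨fun h => ⟨by rw [h, π.parts_sum], h⟩, And.right⟩
  · intro q hq
    simp only [mem_filter, mem_product, mem_partitionsUpTo] at hq
    obtain ⟨⟨⟨ha, -⟩, ⟨hb, -⟩, ⟨hc, -⟩, hd, -⟩, hn⟩ := hq
    refine mem_image.2 ⟨⟨_, fun {i} hi => ?_, hn.symm⟩, mem_univ _, rfl⟩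
    simp only [two_nsmul, Multiset.mem_add, Multiset.mem_map] at hi
    rcases hi with ((hi | hi) | ⟨k, hk, rfl⟩) | hi | hi
    exacts [ha i hi, hb i hi, Nat.mul_pos two_pos (hc k hk), hd i hi, hd i hi]

variable {R : Type*} [CommRing R] [Algebra ℚ R] [Algebra ℂ R]

theorem quadWeight_smul_eq (s : ℂ) (p : ℕ → R) (a b c d : Multiset ℕ) :
    ((parity (a + b + c.map (2 * ·) + 2 • d) : ℂ) * (s ^ b.sum * quadWeight (a, b, c, d))) •
        ((a + b + c.map (2 * ·) + 2 • d).map p).prod =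
      ((zee a : ℚ)⁻¹ • (a.map fun k => -(-1 : ℂ) ^ k • p k).prod) *
        (((zee b : ℚ)⁻¹ • (b.map fun k => -(-s) ^ k • p k).prod) *
          (((zee (c.map (2 * ·)) : ℚ)⁻¹ • (c.map fun k => p (2 * k)).prod) *
            ((zee (d.map (2 * ·)) : ℚ)⁻¹ • (d.map fun k => p (2 * k / 2) ^ 2).prod))) := by
  have hd : (d.map fun k => p (2 * k / 2) ^ 2).prod = (d.map p).prod ^ 2 := by
    simp only [Nat.mul_div_cancel_left _ two_pos, Multiset.prod_map_pow]
  have hc : ((c.map (2 * ·)).map p).prod = (c.map fun k => p (2 * k)).prod := by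
    rw [Multiset.map_map]
    rfl
  have hsign : (-1 : ℂ) ^ c.card * (-1) ^ c.card = 1 := by
    rw [← mul_pow, neg_one_mul, neg_neg, one_pow]
  rw [parity_add, parity_add, parity_add, parity_map_two_mul, parity_two_nsmul, quadWeight,
    prod_map_smul, prod_map_smul, prod_map_neg_neg_pow, prod_map_neg_neg_pow, hd,
    Multiset.map_add, Multiset.map_add, Multiset.map_add, Multiset.prod_add, Multiset.prod_add,
    Multiset.prod_add, hc, Multiset.map_nsmul, Multiset.prod_nsmul]
  simp only [← Rat.cast_smul_eq_qsmul ℂ, smul_smul, smul_mul_smul_comm, one_pow, mul_one]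
  congr 1
  · push_cast
    rw [div_eq_mul_inv, mul_inv, mul_inv, mul_inv]
    linear_combination ((parity a : ℂ) * parity b * s ^ b.sum * (zee a : ℂ)⁻¹ * (zee b : ℂ)⁻¹ *
      (zee (c.map (2 * ·)) : ℂ)⁻¹ * (zee (d.map (2 * ·)) : ℂ)⁻¹) * hsign
  · ring

omit [Algebra ℚ R] in
theorem squareWeight_eq_add (p : ℕ → R) :
    squareWeight p = (fun k => -(-1 : ℂ) ^ k • p k) +
      ((fun k => if Even k then p k else 0) + fun k => if Even k then p (k / 2) ^ 2 else 0) := by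
  ext k
  rcases Nat.even_or_odd k with hk | hk
  · simp [squareWeight, hk, hk.neg_one_pow]
  · simp [squareWeight, Nat.not_even_iff_odd.2 hk, hk.neg_one_pow]

theorem sum_parity_mul_coeffSign_smul (s : ℂ) (n : ℕ) (p : ℕ → R) :
    ∑ π : Nat.Partition n, ((parity π.parts : ℂ) * coeffSign s π.parts) • (π.parts.map p).prod =
      PowerSeries.coeff n (expSeries (squareWeight p) * expSeries fun k => -(-s) ^ k • p k) := by
  rw [squareWeight_eq_add, expSeries_add, expSeries_add, mul_right_comm, mul_assoc]
  have htrunc := coeff_mul_eq_of_le (n := n)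
    (fun m hm => coeff_sum_partitionsUpTo (fun k => -(-1 : ℂ) ^ k • p k) hm)
    (coeff_mul_eq_of_le (fun m hm => coeff_sum_partitionsUpTo (fun k => -(-s) ^ k • p k) hm)
      (coeff_mul_eq_of_le (fun m hm => coeff_sum_even_partitionsUpTo p hm)
        (fun m hm => coeff_sum_even_partitionsUpTo (fun k => p (k / 2) ^ 2) hm))) n le_rfl
  rw [← htrunc]
  simp only [sum_mul_sum, ← sum_product', PowerSeries.monomial_mul_monomial, map_sum,
    PowerSeries.coeff_monomial]
  rw [← sum_filter, ← sum_quadruples]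
  refine sum_congr rfl fun π _ => ?_
  rw [coeffSign, mul_sum, sum_smul]
  refine sum_congr rfl fun ⟨a, b, c, d⟩ hq => ?_
  rw [← (mem_quadruples.1 hq).2.2.2.2]
  exact quadWeight_smul_eq s p a b c d

end Quadruples

section Multiplicities

theorem squareWeight_psum_isSymmetric {σ R : Type*} [Fintype σ] [CommRing R] (k : ℕ) :
    (squareWeight (psum σ R) k).IsSymmetric := by
  rw [squareWeight]
  split_ifs
  · exact fun e => by rw [map_pow, psum_isSymmetric σ R (k / 2) e]
  · exact psum_isSymmetric σ R k

variable {n N : ℕ} (lam : Nat.Partition n)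

theorem schurCoeff_cycleExp_squareWeight (hN : n ≤ N) :
    schurCoeff (rowFun N (diagram lam)) (cycleExp (squareWeight (psum (Fin N) ℂ)) n) = 1 := by
  have hfact : (n.factorial : ℂ) ≠ 0 := Nat.cast_ne_zero.2 n.factorial_ne_zero
  refine mul_left_cancel₀ hfact ?_
  calc (n.factorial : ℂ) * schurCoeff (rowFun N (diagram lam))
        (cycleExp (squareWeight (psum (Fin N) ℂ)) n)
      = schurCoeff (rowFun N (diagram lam))
          (∑ h : Equiv.Perm (Fin n), cycleProd (squareWeight (psum (Fin N) ℂ)) h) := by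
        rw [sum_cycleProd, Fintype.card_fin, ← nsmul_eq_mul, ← nsmul_eq_mul, map_nsmul]
    _ = ∑ h : Equiv.Perm (Fin n), (spechtRep lam).character (h * h) := by
        simp only [map_sum, ← cycleProd_mul_self, ← chi_permType, chi_eq_frobeniusCoeff hN,
          frobeniusCoeff_permType]
    _ = n.factorial * 1 := by rw [sum_character_sq, mul_one]

theorem schurCoeff_mul_prod_X_eq_ite (hN : n ≤ N) {m : ℕ} {S : Finset (Fin N)}
    [Decidable (IsRemovable (rowFun N (diagram lam)) S)] (hm : m + #S = n) :
    schurCoeff (rowFun N (diagram lam))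
        (cycleExp (squareWeight (psum (Fin N) ℂ)) m * ∏ i ∈ S, X i) =
      if IsRemovable (rowFun N (diagram lam)) S then 1 else 0 := by
  have hl := antitone_rowFun (N := N) (diagram lam)
  split_ifs with h
  · obtain ⟨μ, hμ, hS⟩ := (isRemovable_iff hl S).1 h
    have hsum : ∑ i, μ i = m := by
      have hn := sum_rowFun_diagram lam hN
      rw [sum_congr rfl fun i _ => hS i, sum_add_distrib, sum_ite_mem, univ_inter, sum_const,
        smul_eq_mul, mul_one] at hn
      omega
    obtain ⟨nu, rfl⟩ := exists_rowFun_diagram_eq hμ hsum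
    rw [schurCoeff_mul_prod_X_of_eq hS, schurCoeff_cycleExp_squareWeight nu (by omega)]
  · by_contra hne
    exact h ((isRemovable_iff hl S).2 (exists_antitone_of_schurCoeff_mul_prod_X_ne_zero
      (cycleExp_isSymmetric squareWeight_psum_isSymmetric m) hl hne))

theorem schurCoeff_esymm_mul_cycleExp_squareWeight
    [DecidablePred (IsRemovable (rowFun n (diagram lam)))] (s : ℂ) {j : ℕ} (hj : j ≤ n) :
    schurCoeff (rowFun n (diagram lam))
        (s ^ j • esymm (Fin n) ℂ j * cycleExp (squareWeight (psum (Fin n) ℂ)) (n - j)) =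
      ∑ S ∈ powersetCard j univ, if IsRemovable (rowFun n (diagram lam)) S then s ^ #S else 0 := by
  rw [smul_mul_assoc, map_smul, mul_comm, schurCoeff_mul_esymm, smul_sum]
  refine sum_congr rfl fun S hS => ?_
  have hcard := (mem_powersetCard.1 hS).2
  rw [schurCoeff_mul_prod_X_eq_ite lam le_rfl (by omega), hcard, smul_ite, smul_zero, smul_eq_mul,
    mul_one]

theorem sum_mul_chi (hN : n ≤ N) (c : Nat.Partition n → ℂ) :
    ∑ π, c π * chi lam π = schurCoeff (rowFun N (diagram lam))
      (∑ π : Nat.Partition n, c π • (π.parts.map (psum (Fin N) ℂ)).prod) := by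
  simp only [map_sum, map_smul, smul_eq_mul, chi_eq_frobeniusCoeff hN, frobeniusCoeff]

theorem sum_parity_mul_coeffSign_mul_chi (s : ℂ) :
    ∑ π : Nat.Partition n, (parity π.parts : ℂ) * coeffSign s π.parts * chi lam π =
      ∏ v ∈ Icc 1 n, ∑ j ∈ range (lam.parts.count v + 1), s ^ j := by
  classical
  have hl (i : Fin n) : rowFun n (diagram lam) i ≤ n := rowLen_diagram_le lam i
  calc ∑ π : Nat.Partition n, (parity π.parts : ℂ) * coeffSign s π.parts * chi lam π
      = ∑ j ∈ range (n + 1), schurCoeff (rowFun n (diagram lam))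
          (s ^ j • esymm (Fin n) ℂ j * cycleExp (squareWeight (psum (Fin n) ℂ)) (n - j)) := by
        rw [sum_mul_chi lam le_rfl, sum_parity_mul_coeffSign_smul, mul_comm, PowerSeries.coeff_mul,
          Nat.sum_antidiagonal_eq_sum_range_succ_mk, map_sum]
        simp only [coeff_expSeries, cycleExp_neg_psum]
    _ = ∑ S with IsRemovable (rowFun n (diagram lam)) S, s ^ #S := by
        rw [sum_congr rfl fun j hj => schurCoeff_esymm_mul_cycleExp_squareWeight lam s
          (Nat.lt_succ_iff.1 (mem_range.1 hj)), sum_filter, ← powerset_univ, sum_powerset,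
          card_univ, Fintype.card_fin]
    _ = ∏ v ∈ Icc 1 n, ∑ j ∈ range (lam.parts.count v + 1), s ^ j := by
        rw [sum_pow_card_isRemovable s hl]
        refine prod_congr rfl fun v hv => ?_
        rw [count_parts lam le_rfl (Nat.one_le_iff_ne_zero.1 (mem_Icc.1 hv).1)]

theorem sum_range_succ_neg_one_pow (R : Type*) [Ring R] (r : ℕ) :
    ∑ j ∈ range (r + 1), (-1 : R) ^ j = if Even r then 1 else 0 := by
  rw [neg_one_geom_sum]
  simp only [Nat.even_add_one, ite_not]

end Multiplicities

end SchurMult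

theorem mainTheorem5 (n : ℕ) (lam : Nat.Partition n) :
    SchurMult.aPlus lam = ∏ i ∈ Finset.Icc 1 n, ((lam.parts.count i : ℂ) + 1) ∧
    SchurMult.aMinus lam = if ∀ k ∈ SchurMult.conjParts lam, Even k then 1 else 0 := by
  constructor
  · simp only [SchurMult.aPlus, ← SchurMult.coeffSign_one,
      SchurMult.sum_parity_mul_coeffSign_mul_chi]
    simp
  · simp only [SchurMult.aMinus, ← SchurMult.coeffSign_neg_one,
      SchurMult.sum_parity_mul_coeffSign_mul_chi, SchurMult.sum_range_succ_neg_one_pow,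
      Finset.prod_ite_zero, Finset.prod_const_one, SchurMult.forall_conjParts_even_iff,
      SchurMult.forall_even_colLen_iff]
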